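/- **Setting.** There are $N$ users, one operator and $m$ timeslots. User $i$ has a private schedule $b_i\in\{0,1\}^m$; put $N^j=\sum_i b_i^j$. Let $0=C_0<C_1<\dots<C_r\le N$ be public capacities, and let ${\sf f}:\mathbb N\to\{0,\dots,r\}$ be a public estimation function: ${\sf f}(0)=0$ and ${\sf f}(x)=l$ if $C_{l-1}<x\le C_l$. Let $S\ge 1$ be a public scaling factor that causes no rounding errors: $S\,{\sf f}(x)/x$ is an integer for $1\le x\le N$. The Paillier cryptosystem has public key $(n,g)$, with $n=pq$ for distinct primes $p,q$, $\gcd(n,(p-1)(q-1))=1$, $\lambda=\mathrm{lcm}(p-1,q-1)$, and $g\in(\mathbb Z/n^2)^*$ such that $L(g^\lambda)$ is invertible modulo $n$, where $L(u)=(u-1)/n$. It encrypts $x\in\mathbb Z/n$ as $\mathbb E[x]=g^x\rho^n \bmod n^2$ with $\rho$ uniform in $(\mathbb Z/n)^*$, and decrypts by $\mathbb D[c]=L(c^\lambda)L(g^\lambda)^{-1}\bmod n$. Residues above $n/2$ represent negative numbers. **The PP-CFS protocol.** All users hold the key pair; the operator holds only the public key. Every encryption uses fresh randomness, and all random choices are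 uniform and independent. For each timeslot $j$: 1. User $i$ sends $e_i^j=\mathbb E[b_i^j]$ to the operator. The operator draws $R^j\in\mathbb Z/n$ and returns $\big(\prod_{i'}e_{i'}^j\big)\cdot\mathbb E[R^j]\cdot(e_i^j)^{-R^j}$ to user $i$. User $i$ decrypts it and, if $b_i^j=1$, takes the result as $N^j$. 2. The operator draws $R_i^j\in\mathbb Z/n$ for each $i$ and sends it to user $i$. User $i$ sends $\hat E_i^j=\mathbb E[\lfloor S\,{\sf f}(N^j)/N^j\rfloor+R_i^j]$ if $b_i^j=1$, and $\hat E_i^j=\mathbb E[R_i^j]$ if $b_i^j=0$. The operator sends $\prod_i\hat E_i^j$ to all users. They decrypt it and return the result $\hat D^j$. The operator outputs $\tilde c^j=(\hat D^j-\sum_iR_i^j)/S$. All parties follow the protocol and do not collude. The view of a party consists of the keys it holds, its input, its random choices and all messages it receives. A simulator below is a single probabilistic polynomial-time algorithm, which may depend on the public data $N,m,r,S,C,{\sf f}$ but not on the key, the schedules or the security parameter. **Theorem 2 (security of PP-CFS).** (0) If $n>2N$ and $n>2Sr$, then every user $i$ obtains $N^j$ for each $j$ with $b_i^j=1$, and the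 operator obtains $\tilde c^j={\sf f}(N^j)$ for each $j$. (i) *The operator learns only the coarse capacity classes.* There is a simulator which is given only the public key and $({\sf f}(N^j))_{j\le m}$, such that the following holds for every key generator whose primes are at least $2^k$ and whose modulus has polynomially many bits in the security parameter $k$. If the Paillier cryptosystem with this key generator is semantically secure (encryptions are indistinguishable under chosen-plaintext attack by non-uniform probabilistic polynomial-time adversaries), then the output of the simulator and the view of the operator are computationally indistinguishable for non-uniform probabilistic polynomial-time distinguishers, with an advantage that is negligible in $k$, uniformly over all schedules $(b_i)_i$. (ii) *User $i$ learns only $N^j$ for the timeslots he uses, and nothing otherwise.* For every user $i$ there is a simulator which is given only the key pair, $b_i$ and the numbers $N^j$ for those $j$ with $b_i^j=1$, such that for every key pair and all schedules its output has exactly the distribution of the view of user $i$. -/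

import Mathlib

open scoped BigOperators

noncomputable section

namespace PPCFS

/-! ### Randomized algorithms with a cost measure

A program is a straight-line list of arithmetic instructions on registers that hold natural
numbers. An execution is charged the total bit length of all the values that it writes or
outputs, so that each instruction can be carried out in time polynomial in what has been charged
so far (plus the length of the input). Families of programs of polynomial cost therefore are, up
to negligible sampling errors, the non-uniform probabilistic polynomial-time algorithms (Boolean
circuits are the special case of programs on bits), and a *single* program of polynomial cost is
a (uniform) probabilistic polynomial-time algorithm. -/

/-- Instructions; the first argument is the register that is written. -/
inductive Instr where
  | const (d c : ℕ)
  | add (d x y : ℕ)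
  | sub (d x y : ℕ)
  | mul (d x y : ℕ)
  | div (d x y : ℕ)
  | mod (d x y : ℕ)
  | powMod (d x y z : ℕ)
  | rand (d x : ℕ)
  | randUnit (d x : ℕ)

/-- The register that is written. -/
def Instr.dst : Instr → ℕ
  | .const d _ => d
  | .add d _ _ => d
  | .sub d _ _ => d
  | .mul d _ _ => d
  | .div d _ _ => d
  | .mod d _ _ => d
  | .powMod d _ _ _ => d
  | .rand d _ => d
  | .randUnit d _ => d

/-- The uniform distribution on a finite set of numbers (the constant `0` if the set is empty). -/
def uniformOn (A : Finset ℕ) : PMF ℕ :=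
  open Classical in if h : A.Nonempty then PMF.uniformOfFinset A h else PMF.pure 0

/-- The (random) value that an instruction computes from the register contents `s`:
`rand` samples uniformly from `{0, …, s x - 1}`, and `randUnit` samples uniformly from the members
of this set that are invertible modulo `s x`. -/
def Instr.eval (s : ℕ → ℕ) : Instr → PMF ℕ
  | .const _ c => PMF.pure c
  | .add _ x y => PMF.pure (s x + s y)
  | .sub _ x y => PMF.pure (s x - s y)
  | .mul _ x y => PMF.pure (s x * s y)
  | .div _ x y => PMF.pure (s x / s y)
  | .mod _ x y => PMF.pure (s x % s y)
  | .powMod _ x y z => PMF.pure (if s z = 0 then 0 else s x ^ s y % s z)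
  | .rand _ x => uniformOn (Finset.range (s x))
  | .randUnit _ x => uniformOn ((Finset.range (s x)).filter fun y => Nat.Coprime y (s x))

/-- Total length, in bits, of a list of numbers, plus the number of its entries. -/
def listSize (l : List ℕ) : ℕ := (l.map fun v => Nat.size v + 1).sum

/-- Execution of a list of instructions: final register contents and the cost incurred. -/
def runCode : List Instr → (ℕ → ℕ) → PMF ((ℕ → ℕ) × ℕ)
  | [], s => PMF.pure (s, 0)
  | i :: l, s => (i.eval s).bind fun v =>
      (runCode l (Function.update s i.dst v)).map fun t => (t.1, t.2 + (Nat.size v + 1))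

/-- A program: its instructions and the registers that it outputs at the end. -/
structure Prog where
  code : List Instr
  out : List ℕ

/-- Output and total cost of a program on an input, which is put into the registers `0, 1, 2, …`
(all other registers start with `0`). -/
def Prog.execCost (P : Prog) (inp : List ℕ) : PMF (List ℕ × ℕ) :=
  (runCode P.code fun i => inp.getD i 0).map fun t =>
    (P.out.map t.1, t.2 + listSize (P.out.map t.1))

/-- Output distribution of a program. -/
def Prog.exec (P : Prog) (inp : List ℕ) : PMF (List ℕ) := (P.execCost inp).map Prod.fst

/-- A family of programs, indexed by the security parameter, whose worst-case cost is polynomial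
in the security parameter and the length of the input. -/
def PolyTime (A : ℕ → Prog) : Prop :=
  ∃ P : Polynomial ℕ, ∀ (k : ℕ) (inp : List ℕ), ∀ t ∈ ((A k).execCost inp).support,
    t.2 ≤ P.eval (k + listSize inp)

/-- One program for all security parameters, of polynomial cost. -/
def Prog.IsPPT (P : Prog) : Prop := PolyTime fun _ => P

/-- Probability that `D` answers `1` on an input drawn from `X`. -/
def acceptProb (D : Prog) (X : PMF (List ℕ)) : ℝ :=
  (((X.bind D.exec).map fun o => o.headD 0) 1).toReal

/-- Negligible functions of the security parameter. -/
def Negligible (ε : ℕ → ℝ) : Prop :=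
  Asymptotics.SuperpolynomialDecay Filter.atTop (fun k : ℕ => (k : ℝ)) ε

/-- Computational indistinguishability of two ensembles, indexed by the security parameter and
the inputs of the parties, against non-uniform polynomial-time distinguishers. -/
def CompIndist {ι : Type} (X Y : ℕ → ι → PMF (List ℕ)) : Prop :=
  ∀ D : ℕ → Prog, PolyTime D → ∃ ε : ℕ → ℝ, Negligible ε ∧
    ∀ k a, |acceptProb (D k) (X k a) - acceptProb (D k) (Y k a)| ≤ ε k

/-! ### The Paillier cryptosystem -/

/-- The function `L(u) = (u - 1) / n` on `ℤ/n²`. -/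
def paillierL (n : ℕ) (u : ZMod (n ^ 2)) : ℕ := (u.val - 1) / n

/-- A Paillier key pair. The public key is `n = p q` and `g`, the private key is `p`, `q`. -/
structure Key where
  p : ℕ
  q : ℕ
  prime_p : p.Prime
  prime_q : q.Prime
  ne : p ≠ q
  coprime : Nat.Coprime (p * q) ((p - 1) * (q - 1))
  g : (ZMod ((p * q) ^ 2))ˣ
  isUnit_L : IsUnit
    ((paillierL (p * q) ((g : ZMod ((p * q) ^ 2)) ^ Nat.lcm (p - 1) (q - 1)) : ℕ) : ZMod (p * q))

namespace Key

/-- The modulus; plaintexts are the elements of `ℤ/n`, ciphertexts those of `ℤ/n²`. -/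
abbrev n (K : Key) : ℕ := K.p * K.q

instance (K : Key) : NeZero K.n :=
  ⟨Nat.mul_ne_zero K.prime_p.ne_zero K.prime_q.ne_zero⟩

/-- The generator as an element of `ℤ/n²`. -/
def gen (K : Key) : ZMod (K.n ^ 2) := (K.g : ZMod ((K.p * K.q) ^ 2))

/-- Carmichael's `λ(n)`. -/
def lam (K : Key) : ℕ := Nat.lcm (K.p - 1) (K.q - 1)

/-- Encryption `g ^ x * r ^ n mod n²` of `x` with the random number `r`. -/
def enc (K : Key) (x : ZMod K.n) (r : (ZMod K.n)ˣ) : ZMod (K.n ^ 2) :=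
  K.gen ^ x.val * (((r : ZMod K.n).val : ℕ) : ZMod (K.n ^ 2)) ^ K.n

/-- Decryption `L(c ^ λ) * L(g ^ λ)⁻¹ mod n`. -/
def dec (K : Key) (c : ZMod (K.n ^ 2)) : ZMod K.n :=
  (paillierL K.n (c ^ K.lam) : ZMod K.n) * (paillierL K.n (K.gen ^ K.lam) : ZMod K.n)⁻¹

/-- The public key as a list of numbers. -/
def pub (K : Key) : List ℕ := [K.n, K.gen.val]

/-- The whole key pair as a list of numbers. -/
def priv (K : Key) : List ℕ := [K.p, K.q, K.gen.val]

end Key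

/-- A key generator: for security parameter `k` it draws the key pair from some distribution in
which both primes are at least `2 ^ k` and the modulus has polynomially many bits. -/
def IsKeyGen (G : ℕ → PMF Key) : Prop :=
  ∃ P : Polynomial ℕ, ∀ k, ∀ K ∈ (G k).support,
    2 ^ k ≤ K.p ∧ 2 ^ k ≤ K.q ∧ K.n < 2 ^ P.eval k

/-- The chosen-plaintext experiment: `A₁` gets the public key and outputs a list whose first two
entries are the challenge messages; message number `β` is encrypted; `A₂` gets the output of `A₁`
and the ciphertext, and answers with a number. -/
def cpaExperiment (G : ℕ → PMF Key) (A₁ A₂ : ℕ → Prog) (k : ℕ) (β : Fin 2) : PMF ℕ :=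
  (G k).bind fun K =>
  ((A₁ k).exec K.pub).bind fun st =>
  (PMF.uniformOfFintype (ZMod K.n)ˣ).bind fun r =>
  ((A₂ k).exec (st ++ [(K.enc ((st.getD β 0 : ℕ) : ZMod K.n) r).val])).map fun o => o.headD 0

/-- Privacy (semantic security) of the cryptosystem: indistinguishability of encryptions under
chosen-plaintext attack by non-uniform probabilistic polynomial-time adversaries. -/
def SemanticallySecure (G : ℕ → PMF Key) : Prop :=
  ∀ A₁ A₂ : ℕ → Prog, PolyTime A₁ → PolyTime A₂ →
    Negligible fun k =>
      |((cpaExperiment G A₁ A₂ k 0) 1).toReal - ((cpaExperiment G A₁ A₂ k 1) 1).toReal|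

/-! ### The facility sharing problem -/

/-- Capacities `0 = C₀ < C₁ < ⋯ < C_r ≤ N`. -/
def IsCapacitySeq (N : ℕ) {r : ℕ} (C : Fin (r + 1) → ℕ) : Prop :=
  C 0 = 0 ∧ StrictMono C ∧ C (Fin.last r) ≤ N

/-- An estimation function, with values in `{0, …, r}`: `f x = l` if `C_{l-1} < x ≤ C_l`, and an
unused timeslot is in class `0`. (Nothing else is prescribed above `C_r`.) -/
def IsEstimation {r : ℕ} (C : Fin (r + 1) → ℕ) (f : ℕ → ℕ) : Prop :=
  f 0 = 0 ∧ (∀ x, f x ≤ r) ∧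
    ∀ (l : Fin r) (x : ℕ), C l.castSucc < x → x ≤ C l.succ → f x = (l : ℕ) + 1

/-- `N^j`: the number of users who request timeslot `j`. -/
def usersAt {N m : ℕ} (b : Fin N → Fin m → Bool) (j : Fin m) : ℕ := ∑ i, (b i j).toNat

/-- `a_i^j`: what user `i` is given about timeslot `j`. -/
def userShare {N m : ℕ} (b : Fin N → Fin m → Bool) (i : Fin N) (j : Fin m) : Option ℕ :=
  if b i j then some (usersAt b j) else none

/-! ### The protocol -/

/-- The independent random choices of one execution with key `K`: the random numbers of the
users for their encryptions in Stage 1 and in Stage 2, the random number of the operator for the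
encryption of `R^j`, and his masks `R^j` and `R_i^j`. -/
abbrev Coins (N m : ℕ) (K : Key) : Type :=
  (Fin N → Fin m → (ZMod K.n)ˣ) × (Fin N → Fin m → (ZMod K.n)ˣ) × (Fin m → (ZMod K.n)ˣ) ×
    (Fin m → ZMod K.n) × (Fin N → Fin m → ZMod K.n)

/-- All random choices are uniform and independent. -/
def coins (N m : ℕ) (K : Key) : PMF (Coins N m K) := PMF.uniformOfFintype _

/-- The number represented by a residue: shift residues above `n / 2` to negative numbers. -/
def decode {n : ℕ} (x : ZMod n) : ℕ := x.valMinAbs.toNat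

/-- A table of numbers as a list. -/
def flat {N m : ℕ} (F : Fin N → Fin m → ℕ) : List ℕ :=
  (List.ofFn fun i => List.ofFn (F i)).flatten

namespace Coins

variable {N m : ℕ} {K : Key}

def r1 (ω : Coins N m K) : Fin N → Fin m → (ZMod K.n)ˣ := ω.1

def r2 (ω : Coins N m K) : Fin N → Fin m → (ZMod K.n)ˣ := ω.2.1

def rOp (ω : Coins N m K) : Fin m → (ZMod K.n)ˣ := ω.2.2.1

def R (ω : Coins N m K) : Fin m → ZMod K.n := ω.2.2.2.1

def mask (ω : Coins N m K) : Fin N → Fin m → ZMod K.n := ω.2.2.2.2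

end Coins

section Protocol

variable {N m : ℕ} (f : ℕ → ℕ) (S : ℕ) (K : Key) (b : Fin N → Fin m → Bool) (ω : Coins N m K)

/-- Stage 1, user `i` to operator: the encryption of `b_i^j`. -/
def bitCipher (i : Fin N) (j : Fin m) : ZMod (K.n ^ 2) :=
  K.enc ((b i j).toNat : ZMod K.n) (ω.r1 i j)

/-- Stage 1, operator to user `i`. -/
def replyCipher (i : Fin N) (j : Fin m) : ZMod (K.n ^ 2) :=
  (∏ i', bitCipher K b ω i' j) * K.enc (ω.R j) (ω.rOp j) * (bitCipher K b ω i j ^ (ω.R j).val)⁻¹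

/-- Stage 1: the number that user `i` decrypts. -/
def decrypted (i : Fin N) (j : Fin m) : ℕ := decode (K.dec (replyCipher K b ω i j))

/-- The output of user `i`. -/
def userOutput (i : Fin N) (j : Fin m) : Option ℕ :=
  if b i j then some (decrypted K b ω i j) else none

/-- Stage 2, user `i` to operator: the encryption of `f(N^j) / N^j + R_i^j` (the fraction scaled
by `S` and rounded down) if `i` requests timeslot `j`, and of `R_i^j` otherwise. The masks `R_i^j`
have been sent to `i` before. -/
def shareCipher (i : Fin N) (j : Fin m) : ZMod (K.n ^ 2) :=
  K.enc ((if b i j then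
      ((S * f (decrypted K b ω i j) / decrypted K b ω i j : ℕ) : ZMod K.n) else 0) + ω.mask i j)
    (ω.r2 i j)

/-- Stage 2, operator to all users. -/
def productCipher (j : Fin m) : ZMod (K.n ^ 2) := ∏ i, shareCipher f S K b ω i j

/-- Stage 2, every user to operator: the decrypted product. -/
def aggregate (j : Fin m) : ZMod K.n := K.dec (productCipher f S K b ω j)

/-- The output of the operator: remove the masks and the scaling factor. -/
def operatorOutput (j : Fin m) : ℕ :=
  decode (aggregate f S K b ω j - ∑ i, ω.mask i j) / S

/-- The view of the operator: the public key, his random choices, all messages he receives. -/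
def operatorView : List ℕ :=
  K.pub ++
  List.ofFn (fun j => (ω.rOp j : ZMod K.n).val) ++
  List.ofFn (fun j => (ω.R j).val) ++
  flat (fun i j => (ω.mask i j).val) ++
  flat (fun i j => (bitCipher K b ω i j).val) ++
  flat (fun i j => (shareCipher f S K b ω i j).val) ++
  flat (fun (_ : Fin N) j => (aggregate f S K b ω j).val)

/-- The view of user `i`: the key pair, his schedule, his random choices, all messages he
receives. -/
def userView (i : Fin N) : List ℕ :=
  K.priv ++
  List.ofFn (fun j => (b i j).toNat) ++
  List.ofFn (fun j => (ω.r1 i j : ZMod K.n).val) ++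
  List.ofFn (fun j => (ω.r2 i j : ZMod K.n).val) ++
  List.ofFn (fun j => (replyCipher K b ω i j).val) ++
  List.ofFn (fun j => (ω.mask i j).val) ++
  List.ofFn (fun j => (productCipher f S K b ω j).val)

end Protocol

/-- What the simulator of the operator is given: the public key and the classes `f(N^j)`. -/
def operatorLeak {N m : ℕ} (f : ℕ → ℕ) (K : Key) (b : Fin N → Fin m → Bool) : List ℕ :=
  K.pub ++ List.ofFn fun j => f (usersAt b j)

/-- What the simulator of user `i` is given: the key pair, the schedule of `i`, and `a_i`
(with `0` in the timeslots that `i` does not request). -/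
def userLeak {N m : ℕ} (K : Key) (b : Fin N → Fin m → Bool) (i : Fin N) : List ℕ :=
  K.priv ++ List.ofFn (fun j => (b i j).toNat) ++
    List.ofFn fun j => (userShare b i j).getD 0

end PPCFS

end

open scoped BigOperators

noncomputable section

namespace PPCFS

/-! ### Uniform distributions -/

theorem pmf_bind_congr {α β : Type*} (p : PMF α) (f g : α → PMF β)
    (h : ∀ a ∈ p.support, f a = g a) : p.bind f = p.bind g := by
  ext b
  rw [PMF.bind_apply, PMF.bind_apply]
  refine tsum_congr fun a => ?_
  by_cases ha : a ∈ p.support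
  · rw [h a ha]
  · rw [(PMF.apply_eq_zero_iff p a).2 ha, zero_mul, zero_mul]

theorem pmf_map_injective_apply {α β : Type*} (p : PMF α) (v : α → β)
    (hv : Function.Injective v) (a : α) : p.map v (v a) = p a := by
  classical
  rw [PMF.map_apply, tsum_eq_single a]
  · simp
  · intro a' ha'
    exact if_neg fun h => ha' (hv h).symm

theorem uniformOn_eq_map {A : Type*} [Fintype A] [Nonempty A] (F : Finset ℕ) (v : A → ℕ)
    (hv : Function.Injective v) (hF : ∀ x, x ∈ F ↔ ∃ a, v a = x) :
    uniformOn F = (PMF.uniformOfFintype A).map v := by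
  classical
  have hFim : F = Finset.univ.image v := by
    ext x; simp [hF]
  have hne : F.Nonempty := by
    obtain ⟨a⟩ := ‹Nonempty A›
    exact ⟨v a, (hF _).2 ⟨a, rfl⟩⟩
  have hcard : F.card = Fintype.card A := by
    rw [hFim, Finset.card_image_of_injective _ hv, Finset.card_univ]
  rw [uniformOn, dif_pos hne]
  ext x
  by_cases hx : x ∈ F
  · obtain ⟨a, rfl⟩ := (hF x).1 hx
    rw [PMF.uniformOfFinset_apply_of_mem _ hx, pmf_map_injective_apply _ _ hv,
      PMF.uniformOfFintype_apply, hcard]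
  · rw [PMF.uniformOfFinset_apply_of_notMem _ hx, eq_comm, PMF.apply_eq_zero_iff,
      PMF.mem_support_map_iff]
    rintro ⟨a, -, rfl⟩
    exact hx ((hF _).2 ⟨a, rfl⟩)

theorem uniform_map_bijective {α β : Type*} [Fintype α] [Nonempty α] [Fintype β] [Nonempty β]
    (e : α → β) (he : Function.Bijective e) :
    (PMF.uniformOfFintype α).map e = PMF.uniformOfFintype β := by
  ext b
  obtain ⟨a, rfl⟩ := he.2 b
  rw [pmf_map_injective_apply _ _ he.1, PMF.uniformOfFintype_apply, PMF.uniformOfFintype_apply,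
    Fintype.card_of_bijective he]

theorem uniform_prod {α β : Type*} [Fintype α] [Nonempty α] [Fintype β] [Nonempty β] :
    PMF.uniformOfFintype (α × β) = (PMF.uniformOfFintype α).bind fun a =>
      (PMF.uniformOfFintype β).map (Prod.mk a) := by
  ext ⟨a, b⟩
  rw [PMF.bind_apply, tsum_eq_single a]
  · rw [pmf_map_injective_apply _ _ (Prod.mk_right_injective a), PMF.uniformOfFintype_apply,
      PMF.uniformOfFintype_apply, PMF.uniformOfFintype_apply, Fintype.card_prod, Nat.cast_mul,
      ENNReal.mul_inv]
    · right; exact ENNReal.natCast_ne_top _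
    · left; exact ENNReal.natCast_ne_top _
  · intro a' ha'
    refine mul_eq_zero_of_right _ ((PMF.apply_eq_zero_iff _ _).2 ?_)
    rw [PMF.mem_support_map_iff]
    rintro ⟨b', -, h⟩
    exact ha' (congrArg Prod.fst h)

theorem uniform_prod_map {α β γ : Type*} [Fintype α] [Nonempty α] [Fintype β] [Nonempty β]
    (h : α × β → γ) :
    (PMF.uniformOfFintype (α × β)).map h = (PMF.uniformOfFintype α).bind fun a =>
      (PMF.uniformOfFintype β).map fun b => h (a, b) := by
  rw [uniform_prod, PMF.map_bind]
  congr 1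
  funext a
  rw [PMF.map_comp]
  rfl

/-- Resampling a part of a uniform random variable leaves it uniform. -/
theorem uniform_resample {α β γ : Type*} [Fintype α] [Nonempty α] [Fintype β] [Nonempty β]
    (get : α → β) (set : α → β → α) (h1 : ∀ a b, get (set a b) = b)
    (h2 : ∀ a, set a (get a) = a) (h3 : ∀ a b b', set (set a b) b' = set a b')
    (F : α → PMF γ) :
    ((PMF.uniformOfFintype α).bind fun a => (PMF.uniformOfFintype β).bind fun b => F (set a b)) =
      (PMF.uniformOfFintype α).bind F := by
  have hinv : Function.Involutive fun x : α × β => (set x.1 x.2, get x.1) := by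
    rintro ⟨a, b⟩
    simp [h1, h2, h3]
  have key := uniform_map_bijective _ hinv.bijective
  calc _ = (PMF.uniformOfFintype (α × β)).bind fun x => F (set x.1 x.2) := by
        rw [uniform_prod, PMF.bind_bind]
        congr 1; funext a
        rw [PMF.bind_map]; rfl
    _ = ((PMF.uniformOfFintype (α × β)).map
          fun x : α × β => (set x.1 x.2, get x.1)).bind fun x => F x.1 := by
        rw [PMF.bind_map]; rfl
    _ = _ := by
        rw [key, uniform_prod, PMF.bind_bind]
        congr 1; funext a
        rw [PMF.bind_map]
        exact PMF.bind_const (PMF.uniformOfFintype β) (F a)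

theorem uniformOn_range (n : ℕ) [NeZero n] :
    uniformOn (Finset.range n) = (PMF.uniformOfFintype (ZMod n)).map ZMod.val := by
  refine uniformOn_eq_map _ _ (ZMod.val_injective n) fun x => ?_
  rw [Finset.mem_range]
  exact ⟨fun hx => ⟨x, ZMod.val_cast_of_lt hx⟩, fun ⟨a, ha⟩ => ha ▸ ZMod.val_lt a⟩

theorem uniformOn_units (n : ℕ) [NeZero n] :
    uniformOn ((Finset.range n).filter fun y => Nat.Coprime y n) =
      (PMF.uniformOfFintype (ZMod n)ˣ).map fun u : (ZMod n)ˣ => (u : ZMod n).val := by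
  refine uniformOn_eq_map _ _ (fun u v h => Units.ext (ZMod.val_injective n h)) fun x => ?_
  rw [Finset.mem_filter, Finset.mem_range]
  constructor
  · rintro ⟨hx, hc⟩
    exact ⟨ZMod.unitOfCoprime x hc, by rw [ZMod.coe_unitOfCoprime, ZMod.val_cast_of_lt hx]⟩
  · rintro ⟨u, rfl⟩
    exact ⟨ZMod.val_lt _, ZMod.val_coe_unit_coprime u⟩

/-! ### Executions -/

/-- The final register contents. -/
def run (l : List Instr) (s : ℕ → ℕ) : PMF (ℕ → ℕ) := (runCode l s).map Prod.fst

theorem run_nil (s : ℕ → ℕ) : run [] s = PMF.pure s := by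
  simp [run, runCode, PMF.pure_map]

theorem run_cons (i : Instr) (l : List Instr) (s : ℕ → ℕ) :
    run (i :: l) s = (i.eval s).bind fun v => run l (Function.update s i.dst v) := by
  simp only [run, runCode, PMF.map_bind, PMF.map_comp]
  rfl

theorem run_append (l₁ l₂ : List Instr) (s : ℕ → ℕ) :
    run (l₁ ++ l₂) s = (run l₁ s).bind (run l₂) := by
  induction l₁ generalizing s with
  | nil => rw [run_nil, PMF.pure_bind, List.nil_append]
  | cons i l ih => simp only [List.cons_append, run_cons, ih, PMF.bind_bind]

theorem run_singleton (i : Instr) (s : ℕ → ℕ) :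
    run [i] s = (i.eval s).map fun v => Function.update s i.dst v := by
  rw [run_cons]
  simp only [run_nil]
  rfl

theorem exec_eq (P : Prog) (inp : List ℕ) :
    P.exec inp = (run P.code fun i => inp.getD i 0).map fun t => P.out.map t := by
  simp only [Prog.exec, Prog.execCost, run, PMF.map_comp]
  rfl

theorem runCode_append_support (l₁ l₂ : List Instr) (s : ℕ → ℕ) (t : (ℕ → ℕ) × ℕ)
    (ht : t ∈ (runCode (l₁ ++ l₂) s).support) :
    ∃ u ∈ (runCode l₁ s).support, ∃ w ∈ (runCode l₂ u.1).support,
      t = (w.1, u.2 + w.2) := by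
  induction l₁ generalizing s t with
  | nil => exact ⟨(s, 0), by simp [runCode], t, ht, by simp⟩
  | cons i l ih =>
    simp only [List.cons_append, runCode, PMF.mem_support_bind_iff, PMF.mem_support_map_iff] at ht ⊢
    obtain ⟨v, hv, t', ht', rfl⟩ := ht
    obtain ⟨u, hu, w, hw, rfl⟩ := ih _ _ ht'
    exact ⟨_, ⟨v, hv, u, hu, rfl⟩, w, hw, by simp; omega⟩

/-! ### Costs -/

theorem mem_support_uniformOn {F : Finset ℕ} {v : ℕ} (hv : v ∈ (uniformOn F).support) :
    v ∈ F ∨ v = 0 := by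
  unfold uniformOn at hv
  split_ifs at hv with h
  · left; simpa using hv
  · right; simpa using hv

theorem size_add_le (a b M : ℕ) (ha : a.size ≤ M) (hb : b.size ≤ M) :
    (a + b).size ≤ M + 1 := by
  rw [Nat.size_le] at *
  rw [pow_succ]; omega

theorem size_mul_le (a b M : ℕ) (ha : a.size ≤ M) (hb : b.size ≤ M) :
    (a * b).size ≤ 2 * M := by
  rw [Nat.size_le] at *
  rw [two_mul, pow_add]
  exact Nat.mul_lt_mul'' ha hb

/-- The length of a constant that an instruction loads. -/
def Instr.constSize : Instr → ℕ
  | .const _ c => c.size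
  | _ => 0

theorem size_eval_le (i : Instr) (s : ℕ → ℕ) (M : ℕ) (hs : ∀ x, (s x).size ≤ M) (v : ℕ)
    (hv : v ∈ (i.eval s).support) : v.size ≤ 2 * M + 1 + i.constSize := by
  cases i with
  | const d c => simp [Instr.eval] at hv; subst hv; simp [Instr.constSize]
  | add d x y =>
    simp [Instr.eval] at hv; subst hv
    have := size_add_le _ _ M (hs x) (hs y); simp [Instr.constSize]; omega
  | sub d x y =>
    simp [Instr.eval] at hv; subst hv
    have := (Nat.size_le_size (Nat.sub_le (s x) (s y))).trans (hs x)
    simp [Instr.constSize]; omega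
  | mul d x y =>
    simp [Instr.eval] at hv; subst hv
    have := size_mul_le _ _ M (hs x) (hs y); simp [Instr.constSize]; omega
  | div d x y =>
    simp [Instr.eval] at hv; subst hv
    have := (Nat.size_le_size (Nat.div_le_self (s x) (s y))).trans (hs x)
    simp [Instr.constSize]; omega
  | mod d x y =>
    simp [Instr.eval] at hv; subst hv
    have := (Nat.size_le_size (Nat.mod_le (s x) (s y))).trans (hs x)
    simp [Instr.constSize]; omega
  | powMod d x y z =>
    simp [Instr.eval] at hv; subst hv
    have : (if s z = 0 then 0 else s x ^ s y % s z) ≤ s z := by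
      split_ifs with h
      · omega
      · exact (Nat.mod_lt _ (Nat.pos_of_ne_zero h)).le
    have := (Nat.size_le_size this).trans (hs z)
    simp only [Instr.constSize]; omega
  | rand d x =>
    have : v ≤ s x := by
      rcases mem_support_uniformOn hv with h | h
      · exact (Finset.mem_range.1 h).le
      · omega
    have := (Nat.size_le_size this).trans (hs x)
    simp only [Instr.constSize]; omega
  | randUnit d x =>
    have : v ≤ s x := by
      rcases mem_support_uniformOn hv with h | h
      · exact (Finset.mem_range.1 (Finset.mem_filter.1 h).1).le
      · omega
    have := (Nat.size_le_size this).trans (hs x)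
    simp only [Instr.constSize]; omega

/-- A fixed list of instructions increases lengths at most linearly, at linear cost. -/
theorem runCode_linear (l : List Instr) : ∃ a b : ℕ, ∀ (s : ℕ → ℕ) (M : ℕ),
    (∀ x, (s x).size ≤ M) → ∀ t ∈ (runCode l s).support,
      (∀ x, (t.1 x).size ≤ a * M + b) ∧ t.2 ≤ a * M + b := by
  induction l with
  | nil =>
    refine ⟨1, 0, fun s M hs t ht => ?_⟩
    simp [runCode] at ht
    subst ht
    simpa using hs
  | cons i l ih =>
    obtain ⟨a, b, h⟩ := ih
    refine ⟨2 * a + 2, a * (1 + i.constSize) + b + i.constSize + 2, fun s M hs t ht => ?_⟩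
    simp only [runCode, PMF.mem_support_bind_iff, PMF.mem_support_map_iff] at ht
    obtain ⟨v, hv, u, hu, rfl⟩ := ht
    have hv' := size_eval_le i s M hs v hv
    have := h (Function.update s i.dst v) (2 * M + 1 + i.constSize) (fun x => by
      by_cases hx : x = i.dst
      · subst hx; simpa using hv'
      · rw [Function.update_of_ne hx]; have := hs x; omega) u hu
    have e : a * (2 * M + 1 + i.constSize) + b = 2 * a * M + (a * (1 + i.constSize) + b) := by ring
    have e2 : (2 * a + 2) * M = 2 * a * M + 2 * M := by ring
    rw [e] at this
    rw [e2]
    refine ⟨fun x => ?_, ?_⟩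
    · have := this.1 x; show (u.1 x).size ≤ _; omega
    · have := this.2; show u.2 + (v.size + 1) ≤ _; omega

theorem runCode_support_of_notMem (l : List Instr) (s : ℕ → ℕ) (t : (ℕ → ℕ) × ℕ)
    (ht : t ∈ (runCode l s).support) (x : ℕ) (hx : ∀ i ∈ l, x ≠ i.dst) : t.1 x = s x := by
  induction l generalizing s t with
  | nil => simp [runCode] at ht; subst ht; rfl
  | cons i l ih =>
    simp only [runCode, PMF.mem_support_bind_iff, PMF.mem_support_map_iff] at ht
    obtain ⟨v, hv, u, hu, rfl⟩ := ht
    have := ih _ u hu fun j hj => hx j (List.mem_cons_of_mem _ hj)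
    rw [Function.update_of_ne (hx i List.mem_cons_self)] at this
    exact this

theorem size_getD_le (inp : List ℕ) (x : ℕ) : (inp.getD x 0).size ≤ listSize inp := by
  by_cases hx : x < inp.length
  · rw [List.getD_eq_getElem _ _ hx]
    have : (inp[x].size + 1) ∈ inp.map fun v => Nat.size v + 1 :=
      List.mem_map.2 ⟨_, List.getElem_mem hx, rfl⟩
    have := List.le_sum_of_mem this
    unfold listSize; omega
  · rw [List.getD_eq_default _ _ (by omega)]; simp

theorem length_le_listSize (inp : List ℕ) : inp.length ≤ listSize inp := by
  unfold listSize
  induction inp with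
  | nil => simp
  | cons a l ih => simp; omega

theorem listSize_le (l : List ℕ) (M : ℕ) (h : ∀ x ∈ l, x.size ≤ M) :
    listSize l ≤ l.length * (M + 1) := by
  unfold listSize
  have := List.sum_le_card_nsmul (l.map fun v => Nat.size v + 1) (M + 1) (by
    intro x hx
    obtain ⟨v, hv, rfl⟩ := List.mem_map.1 hx
    have := h v hv; omega)
  simpa using this

theorem eval_mono (P : Polynomial ℕ) {x y : ℕ} (h : x ≤ y) : P.eval x ≤ P.eval y := by
  induction P using Polynomial.induction_on' with
  | add p q hp hq => rw [Polynomial.eval_add, Polynomial.eval_add]; omega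
  | monomial n a =>
    rw [Polynomial.eval_monomial, Polynomial.eval_monomial]
    gcongr

/-- Every single program is of polynomial cost. -/
theorem Prog.isPPT (P : Prog) : P.IsPPT := by
  obtain ⟨a, b, h⟩ := runCode_linear P.code
  refine ⟨(Polynomial.C a * .X + .C b) +
    .C P.out.length * (.C a * .X + .C b + 1), fun k inp t ht => ?_⟩
  simp only [Prog.execCost, PMF.mem_support_map_iff] at ht
  obtain ⟨u, hu, rfl⟩ := ht
  obtain ⟨h1, h2⟩ := h _ _ (size_getD_le inp) u hu
  have h3 := listSize_le (P.out.map u.1) (a * listSize inp + b) (by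
    intro x hx
    obtain ⟨y, -, rfl⟩ := List.mem_map.1 hx
    exact h1 y)
  rw [List.length_map] at h3
  refine (Nat.add_le_add h2 h3).trans (le_trans (le_of_eq ?_)
    (eval_mono _ (Nat.le_add_left (listSize inp) k)))
  simp

/-- Running a fixed list of instructions before the programs of a family. -/
theorem PolyTime.prepend {D : ℕ → Prog} (hD : PolyTime D) (l : List Instr) :
    PolyTime fun k => ⟨l ++ (D k).code, (D k).out⟩ := by
  obtain ⟨P, hP⟩ := hD
  obtain ⟨a, b, h⟩ := runCode_linear l
  set B : ℕ := (l.map Instr.dst).sum + 1 with hB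
  refine ⟨(Polynomial.C a * .X + .C b) +
    P.comp (.X + (.X + .C B) * (.C a * .X + .C b + 1)), fun k inp t ht => ?_⟩
  simp only [Prog.execCost, PMF.mem_support_map_iff] at ht
  obtain ⟨u, hu, rfl⟩ := ht
  obtain ⟨w, hw, z, hz, rfl⟩ := runCode_append_support _ _ _ _ hu
  obtain ⟨h1, h2⟩ := h _ _ (size_getD_le inp) w hw
  have hw0 : ∀ x, inp.length + B ≤ x → w.1 x = 0 := fun x hx => by
    rw [runCode_support_of_notMem l _ w hw x]
    · exact List.getD_eq_default _ _ (by omega)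
    · intro i hi
      have := List.le_sum_of_mem (List.mem_map_of_mem (f := Instr.dst) hi)
      omega
  set l' : List ℕ := (List.range (inp.length + B)).map w.1 with hl'
  have hst : w.1 = fun i => l'.getD i 0 := by
    funext x
    by_cases hx : x < inp.length + B
    · rw [List.getD_eq_getElem _ _ (by simpa [hl'] using hx)]
      simp [hl']
    · rw [List.getD_eq_default _ _ (by simpa [hl'] using hx), hw0 x (by omega)]
  have hl : listSize l' ≤ (listSize inp + B) * (a * listSize inp + b + 1) := by
    refine (listSize_le l' (a * listSize inp + b) fun x hx => ?_).trans ?_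
    · obtain ⟨y, -, rfl⟩ := List.mem_map.1 hx
      exact h1 y
    · have := length_le_listSize inp
      simp only [hl', List.length_map, List.length_range]
      gcongr
  have hc := hP k l' ((D k).out.map z.1, z.2 + listSize ((D k).out.map z.1)) (by
    simp only [Prog.execCost, PMF.mem_support_map_iff]
    exact ⟨z, by rwa [← hst], rfl⟩)
  have hc2 := hc.trans (eval_mono P (Nat.add_le_add_left hl k))
  set X := k + listSize inp with hX
  have hc3 : z.2 + listSize ((D k).out.map z.1) ≤
      P.eval (X + (X + B) * (a * X + b + 1)) := by
    refine hc2.trans (eval_mono P ?_)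
    have : listSize inp ≤ X := by omega
    gcongr
    omega
  have h4 : w.2 ≤ a * X + b := h2.trans (by gcongr; omega)
  simp only [Polynomial.eval_add, Polynomial.eval_comp, Polynomial.eval_mul, Polynomial.eval_C,
    Polynomial.eval_X, Polynomial.eval_one]
  simp only at *
  omega

section

/-! ### Arithmetic expressions and their compilation -/

/-- Arithmetic expressions in the variables `V`. -/
inductive Expr (V : Type) where
  | var (v : V)
  | const (c : ℕ)
  | add (x y : Expr V)
  | sub (x y : Expr V)
  | mul (x y : Expr V)
  | mod (x y : Expr V)
  | powMod (x y z : Expr V)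

namespace Expr

variable {V : Type}

def eval (env : V → ℕ) : Expr V → ℕ
  | var v => env v
  | const c => c
  | add x y => x.eval env + y.eval env
  | sub x y => x.eval env - y.eval env
  | mul x y => x.eval env * y.eval env
  | mod x y => x.eval env % y.eval env
  | powMod x y z =>
      if z.eval env = 0 then 0 else x.eval env ^ y.eval env % z.eval env

/-- Code that evaluates an expression into register `p` and leaves the registers below `p`
unchanged. -/
def compile (addr : V → ℕ) : Expr V → ℕ → List Instr
  | var v, p => [.const (p + 1) 0, .add p (addr v) (p + 1)]
  | const c, p => [.const p c]
  | add x y, p => x.compile addr p ++ y.compile addr (p + 1) ++ [.add p p (p + 1)]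
  | sub x y, p => x.compile addr p ++ y.compile addr (p + 1) ++ [.sub p p (p + 1)]
  | mul x y, p => x.compile addr p ++ y.compile addr (p + 1) ++ [.mul p p (p + 1)]
  | mod x y, p => x.compile addr p ++ y.compile addr (p + 1) ++ [.mod p p (p + 1)]
  | powMod x y z, p => x.compile addr p ++ y.compile addr (p + 1) ++ z.compile addr (p + 2) ++
      [.powMod p p (p + 1) (p + 2)]

/-- Code that evaluates a list of expressions into the registers `p, p + 1, …`. -/
def compileList (addr : V → ℕ) : List (Expr V) → ℕ → List Instr
  | [], _ => []
  | e :: es, p => e.compile addr p ++ compileList addr es (p + 1)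

theorem run_step {l : List Instr} {s t : ℕ → ℕ} (h : run l s = PMF.pure t) (i : Instr) (v : ℕ)
    (hi : i.eval t = PMF.pure v) :
    run (l ++ [i]) s = PMF.pure (Function.update t i.dst v) := by
  rw [run_append, h, PMF.pure_bind, run_singleton, hi, PMF.pure_map]

theorem run_seq {l l' : List Instr} {s t u : ℕ → ℕ} (h : run l s = PMF.pure t)
    (h' : run l' t = PMF.pure u) : run (l ++ l') s = PMF.pure u := by
  rw [run_append, h, PMF.pure_bind, h']

theorem run_compile (addr : V → ℕ) (env : V → ℕ) (e : Expr V) (p : ℕ) (s : ℕ → ℕ)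
    (hp : ∀ v, addr v < p) (hs : ∀ v, s (addr v) = env v) :
    ∃ t, run (e.compile addr p) s = PMF.pure t ∧ t p = e.eval env ∧ ∀ x < p, t x = s x := by
  induction e generalizing p s with
  | var v =>
    refine ⟨Function.update (Function.update s (p + 1) 0) p (env v), ?_, ?_, ?_⟩
    · simp only [compile, run_cons, run_nil, Instr.eval, PMF.pure_bind, Instr.dst]
      have := hp v
      rw [Function.update_of_ne (by omega), hs v]
      simp
    · simp [eval]
    · intro x hx
      rw [Function.update_of_ne (by omega), Function.update_of_ne (by omega)]
  | const c =>
    refine ⟨Function.update s p c, ?_, ?_, ?_⟩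
    · simp [compile, run_cons, run_nil, Instr.eval, PMF.pure_bind, Instr.dst]
    · simp [eval]
    · intro x hx
      rw [Function.update_of_ne (by omega)]
  | add x y ihx ihy | sub x y ihx ihy | mul x y ihx ihy | mod x y ihx ihy =>
    obtain ⟨t, ht, htp, hts⟩ := ihx p s hp hs
    obtain ⟨u, hu, hup, hut⟩ := ihy (p + 1) t (fun v => (hp v).trans p.lt_succ_self)
      (fun v => by rw [hts _ (hp v), hs v])
    have hpu : u p = x.eval env := by rw [hut p (by omega), htp]
    refine ⟨_, run_step (run_seq ht hu) _ _ rfl, ?_, ?_⟩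
    · simp [Instr.dst, hpu, hup, eval]
    · intro z hz
      rw [Instr.dst, Function.update_of_ne (by omega), hut z (by omega), hts z hz]
  | powMod x y z ihx ihy ihz =>
    obtain ⟨t, ht, htp, hts⟩ := ihx p s hp hs
    obtain ⟨u, hu, hup, hut⟩ := ihy (p + 1) t (fun v => (hp v).trans p.lt_succ_self)
      (fun v => by rw [hts _ (hp v), hs v])
    obtain ⟨w, hw, hwp, hwu⟩ := ihz (p + 2) u (fun v => (hp v).trans (by omega))
      (fun v => by rw [hut _ ((hp v).trans p.lt_succ_self), hts _ (hp v), hs v])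
    have h1 : w p = x.eval env := by rw [hwu p (by omega), hut p (by omega), htp]
    have h2 : w (p + 1) = y.eval env := by rw [hwu _ (by omega), hup]
    refine ⟨_, run_step (run_seq (run_seq ht hu) hw) _ _ rfl, ?_, ?_⟩
    · simp [Instr.dst, h1, h2, hwp, eval]
    · intro z hz
      rw [Instr.dst, Function.update_of_ne (by omega), hwu z (by omega), hut z (by omega),
        hts z hz]

theorem run_compileList (addr : V → ℕ) (env : V → ℕ) (es : List (Expr V)) (p : ℕ) (s : ℕ → ℕ)
    (hp : ∀ v, addr v < p) (hs : ∀ v, s (addr v) = env v) :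
    ∃ t, run (compileList addr es p) s = PMF.pure t ∧
      (List.range' p es.length).map t = es.map (eval env) ∧ ∀ x < p, t x = s x := by
  induction es generalizing p s with
  | nil => exact ⟨s, run_nil s, rfl, fun _ _ => rfl⟩
  | cons e es ih =>
    obtain ⟨t, ht, htp, hts⟩ := run_compile addr env e p s hp hs
    obtain ⟨u, hu, hup, hut⟩ := ih (p + 1) t (fun v => (hp v).trans p.lt_succ_self)
      (fun v => by rw [hts _ (hp v), hs v])
    refine ⟨u, run_seq ht hu, ?_, fun x hx => by rw [hut x (by omega), hts x hx]⟩
    rw [List.length_cons, List.range'_succ, List.map_cons, List.map_cons, hup,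
      hut p (by omega), htp]

end Expr

/-! ### Drawing blocks of random numbers -/

/-- Register contents with the block of registers that starts at `L` overwritten. -/
def overlay (s : ℕ → ℕ) (L : ℕ) {T : ℕ} (w : Fin T → ℕ) (x : ℕ) : ℕ :=
  if h : L ≤ x ∧ x < L + T then w ⟨x - L, by omega⟩ else s x

theorem overlay_of_lt (s : ℕ → ℕ) {L T : ℕ} (w : Fin T → ℕ) {x : ℕ} (hx : x < L) :
    overlay s L w x = s x := dif_neg (by omega)

theorem overlay_of_ge (s : ℕ → ℕ) {L T : ℕ} (w : Fin T → ℕ) {x : ℕ} (hx : L + T ≤ x) :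
    overlay s L w x = s x := dif_neg (by omega)

theorem overlay_at (s : ℕ → ℕ) {L T : ℕ} (w : Fin T → ℕ) (a : Fin T) :
    overlay s L w (L + a) = w a := by
  rw [overlay, dif_pos ⟨by omega, by omega⟩]
  congr 1; ext; simp

theorem overlay_zero (s : ℕ → ℕ) (L : ℕ) (w : Fin 0 → ℕ) : overlay s L w = s := by
  funext x; exact dif_neg (by omega)

theorem overlay_snoc (s : ℕ → ℕ) (L : ℕ) {T : ℕ} (w : Fin (T + 1) → ℕ) :
    Function.update (overlay s L fun t : Fin T => w t.castSucc) (L + T) (w (Fin.last T)) =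
      overlay s L w := by
  funext x
  by_cases hx : x = L + T
  · subst hx
    rw [Function.update_self]
    exact (overlay_at s w (Fin.last T)).symm
  · rw [Function.update_of_ne hx]
    unfold overlay
    by_cases h : L ≤ x ∧ x < L + T
    · rw [dif_pos h, dif_pos ⟨h.1, by omega⟩]; rfl
    · rw [dif_neg h, dif_neg (by omega)]

theorem run_draw {A : Type} [Fintype A] [Nonempty A] (val : A → ℕ) (instr : ℕ → Instr)
    (hdst : ∀ d, (instr d).dst = d) (s : ℕ → ℕ) (L : ℕ)
    (h : ∀ d s', (∀ x < L, s' x = s x) → (instr d).eval s' = (PMF.uniformOfFintype A).map val)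
    (T : ℕ) :
    run ((List.range T).map fun t => instr (L + t)) s =
      (PMF.uniformOfFintype (Fin T → A)).map fun w => overlay s L fun t => val (w t) := by
  induction T with
  | zero =>
    simp only [List.range_zero, List.map_nil, run_nil, overlay_zero]
    exact (PMF.map_const (PMF.uniformOfFintype (Fin 0 → A)) s).symm
  | succ T ih =>
    have hbij : Function.Bijective
        fun x : (Fin T → A) × A => (Fin.snoc x.1 x.2 : Fin (T + 1) → A) := by
      constructor
      · rintro ⟨a, b⟩ ⟨c, d⟩ hx
        have := Fin.snoc_inj.1 hx
        exact Prod.ext this.1 this.2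
      · intro w
        exact ⟨(Fin.init w, w (Fin.last T)), Fin.snoc_init_self w⟩
    rw [List.range_succ, List.map_append, run_append, ih, PMF.bind_map,
      ← uniform_map_bijective _ hbij, PMF.map_comp, uniform_prod_map]
    congr 1
    funext w
    simp only [Function.comp_apply, List.map_cons, List.map_nil]
    rw [run_singleton, h _ _ (fun x hx => overlay_of_lt _ _ hx), PMF.map_comp, hdst]
    congr 1
    funext a
    rw [Function.comp_apply, ← overlay_snoc]
    simp

theorem run_draw_table {A : Type} [Fintype A] [Nonempty A] (val : A → ℕ) (instr : ℕ → Instr)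
    (hdst : ∀ d, (instr d).dst = d) (s : ℕ → ℕ) (L : ℕ)
    (h : ∀ d s', (∀ x < L, s' x = s x) → (instr d).eval s' = (PMF.uniformOfFintype A).map val)
    (N m : ℕ) :
    run ((List.range (N * m)).map fun t => instr (L + t)) s =
      (PMF.uniformOfFintype (Fin N → Fin m → A)).map fun w =>
        overlay s L fun t => val (w (finProdFinEquiv.symm t).1 (finProdFinEquiv.symm t).2) := by
  have hbij : Function.Bijective
      fun (w : Fin (N * m) → A) (i : Fin N) (j : Fin m) => w (finProdFinEquiv (i, j)) := by
    constructor
    · intro w w' hw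
      funext t
      have := congrFun (congrFun hw (finProdFinEquiv.symm t).1) (finProdFinEquiv.symm t).2
      simpa only [Prod.mk.eta, Equiv.apply_symm_apply] using this
    · intro w
      exact ⟨fun t => w (finProdFinEquiv.symm t).1 (finProdFinEquiv.symm t).2, by
        funext i j; simp only [Equiv.symm_apply_apply]⟩
  rw [run_draw val instr hdst s L h, ← uniform_map_bijective _ hbij, PMF.map_comp]
  congr 1
  funext w
  simp only [Function.comp_apply, Prod.mk.eta, Equiv.apply_symm_apply]

/-- Code that draws `T` random units modulo the contents of register `ν`. -/
def drawUnits (ν T L : ℕ) : List Instr := (List.range T).map fun t => .randUnit (L + t) ν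

/-- Code that draws `T` random residues modulo the contents of register `ν`. -/
def drawResidues (ν T L : ℕ) : List Instr := (List.range T).map fun t => .rand (L + t) ν

/-- Code that draws the random choices of one execution of the protocol. -/
def coinCode (N m ν L : ℕ) : List Instr :=
  drawUnits ν (N * m) L ++ (drawUnits ν (N * m) (L + N * m) ++
    (drawUnits ν m (L + 2 * (N * m)) ++ (drawResidues ν m (L + 2 * (N * m) + m) ++
      drawResidues ν (N * m) (L + 2 * (N * m) + 2 * m))))

/-- Names of the random choices of one execution of the protocol. -/
inductive CoinVar (N m : ℕ) where
  | r1 (i : Fin N) (j : Fin m)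
  | r2 (i : Fin N) (j : Fin m)
  | rOp (j : Fin m)
  | R (j : Fin m)
  | mask (i : Fin N) (j : Fin m)

variable {N m : ℕ}

/-- The register of a random choice. -/
def CoinVar.addr (L : ℕ) : CoinVar N m → ℕ
  | r1 i j => L + (finProdFinEquiv (i, j)).val
  | r2 i j => L + N * m + (finProdFinEquiv (i, j)).val
  | rOp j => L + 2 * (N * m) + j
  | R j => L + 2 * (N * m) + m + j
  | mask i j => L + 2 * (N * m) + 2 * m + (finProdFinEquiv (i, j)).val

/-- The number drawn for a random choice. -/
def Coins.env {K : Key} (ω : Coins N m K) : CoinVar N m → ℕ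
  | .r1 i j => (ω.r1 i j : ZMod K.n).val
  | .r2 i j => (ω.r2 i j : ZMod K.n).val
  | .rOp j => (ω.rOp j : ZMod K.n).val
  | .R j => (ω.R j).val
  | .mask i j => (ω.mask i j).val

/-- The number of registers that hold the random choices. -/
def coinSize (N m : ℕ) : ℕ := 3 * (N * m) + 2 * m

theorem CoinVar.addr_lt (L : ℕ) (c : CoinVar N m) : c.addr L < L + coinSize N m := by
  cases c with
  | r1 i j | r2 i j | mask i j =>
    have := (finProdFinEquiv (i, j)).isLt
    simp only [CoinVar.addr, coinSize]; omega
  | rOp j | R j => simp only [CoinVar.addr, coinSize]; omega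

/-- Register contents after the random choices have been drawn. -/
def coinState (s : ℕ → ℕ) (L : ℕ) {K : Key} (ω : Coins N m K) : ℕ → ℕ :=
  overlay (overlay (overlay (overlay (overlay s L
    (fun t => (ω.r1 (finProdFinEquiv.symm t).1 (finProdFinEquiv.symm t).2 : ZMod K.n).val))
    (L + N * m)
    (fun t => (ω.r2 (finProdFinEquiv.symm t).1 (finProdFinEquiv.symm t).2 : ZMod K.n).val))
    (L + 2 * (N * m)) (fun t => (ω.rOp t : ZMod K.n).val))
    (L + 2 * (N * m) + m) (fun t => (ω.R t).val))
    (L + 2 * (N * m) + 2 * m)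
    (fun t => (ω.mask (finProdFinEquiv.symm t).1 (finProdFinEquiv.symm t).2).val)

theorem coinState_of_lt (s : ℕ → ℕ) (L : ℕ) {K : Key} (ω : Coins N m K) {x : ℕ} (hx : x < L) :
    coinState s L ω x = s x := by
  unfold coinState
  rw [overlay_of_lt _ _ (by omega), overlay_of_lt _ _ (by omega), overlay_of_lt _ _ (by omega),
    overlay_of_lt _ _ (by omega), overlay_of_lt _ _ hx]

theorem coinState_addr (s : ℕ → ℕ) (L : ℕ) {K : Key} (ω : Coins N m K) (c : CoinVar N m) :
    coinState s L ω (c.addr L) = ω.env c := by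
  unfold coinState
  cases c with
  | r1 i j =>
    have := (finProdFinEquiv (i, j)).isLt
    simp only [CoinVar.addr]
    rw [overlay_of_lt _ _ (by omega), overlay_of_lt _ _ (by omega), overlay_of_lt _ _ (by omega),
      overlay_of_lt _ _ (by omega), overlay_at]
    simp [Coins.env]
  | r2 i j =>
    have := (finProdFinEquiv (i, j)).isLt
    simp only [CoinVar.addr]
    rw [overlay_of_lt _ _ (by omega), overlay_of_lt _ _ (by omega), overlay_of_lt _ _ (by omega),
      overlay_at]
    simp [Coins.env]
  | rOp j =>
    simp only [CoinVar.addr]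
    rw [overlay_of_lt _ _ (by omega), overlay_of_lt _ _ (by omega), overlay_at]
    simp [Coins.env]
  | R j =>
    simp only [CoinVar.addr]
    rw [overlay_of_lt _ _ (by omega), overlay_at]
    simp [Coins.env]
  | mask i j =>
    simp only [CoinVar.addr]
    rw [overlay_at]
    simp [Coins.env]

theorem run_drawUnits_table (K : Key) (s : ℕ → ℕ) (ν L : ℕ) (hν : ν < L) (hs : s ν = K.n) :
    run (drawUnits ν (N * m) L) s =
      (PMF.uniformOfFintype (Fin N → Fin m → (ZMod K.n)ˣ)).map fun w => overlay s L fun t =>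
        (w (finProdFinEquiv.symm t).1 (finProdFinEquiv.symm t).2 : ZMod K.n).val :=
  run_draw_table (fun u : (ZMod K.n)ˣ => (u : ZMod K.n).val) (fun d => .randUnit d ν)
    (fun _ => rfl) s L (fun d s' h => by
      simp only [Instr.eval]
      rw [h ν hν, hs]
      exact uniformOn_units K.n) N m

theorem run_drawUnits (K : Key) (s : ℕ → ℕ) (ν L : ℕ) (hν : ν < L) (hs : s ν = K.n) :
    run (drawUnits ν m L) s =
      (PMF.uniformOfFintype (Fin m → (ZMod K.n)ˣ)).map fun w =>
        overlay s L fun t => (w t : ZMod K.n).val :=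
  run_draw (fun u : (ZMod K.n)ˣ => (u : ZMod K.n).val) (fun d => .randUnit d ν)
    (fun _ => rfl) s L (fun d s' h => by
      simp only [Instr.eval]
      rw [h ν hν, hs]
      exact uniformOn_units K.n) m

theorem run_drawResidues_table (K : Key) (s : ℕ → ℕ) (ν L : ℕ) (hν : ν < L) (hs : s ν = K.n) :
    run (drawResidues ν (N * m) L) s =
      (PMF.uniformOfFintype (Fin N → Fin m → ZMod K.n)).map fun w => overlay s L fun t =>
        (w (finProdFinEquiv.symm t).1 (finProdFinEquiv.symm t).2).val :=
  run_draw_table (fun u : ZMod K.n => u.val) (fun d => .rand d ν)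
    (fun _ => rfl) s L (fun d s' h => by
      simp only [Instr.eval]
      rw [h ν hν, hs]
      exact uniformOn_range K.n) N m

theorem run_drawResidues (K : Key) (s : ℕ → ℕ) (ν L : ℕ) (hν : ν < L) (hs : s ν = K.n) :
    run (drawResidues ν m L) s =
      (PMF.uniformOfFintype (Fin m → ZMod K.n)).map fun w =>
        overlay s L fun t => (w t).val :=
  run_draw (fun u : ZMod K.n => u.val) (fun d => .rand d ν)
    (fun _ => rfl) s L (fun d s' h => by
      simp only [Instr.eval]
      rw [h ν hν, hs]
      exact uniformOn_range K.n) m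

theorem run_coinCode (K : Key) (s : ℕ → ℕ) (ν L : ℕ) (hν : ν < L) (hs : s ν = K.n) :
    run (coinCode N m ν L) s = (coins N m K).map (coinState s L) := by
  have hov : ∀ {T : ℕ} (s' : ℕ → ℕ) (L' : ℕ) (w : Fin T → ℕ), L ≤ L' → s' ν = K.n →
      overlay s' L' w ν = K.n := fun s' L' w hL h => by
    rw [overlay_of_lt _ _ (by omega), h]
  unfold coins coinCode
  simp only [uniform_prod_map]
  rw [run_append, run_drawUnits_table K s ν L hν hs, PMF.bind_map]
  congr 1; funext w1
  have h1 := hov s L (fun t => (w1 (finProdFinEquiv.symm t).1 (finProdFinEquiv.symm t).2 :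
    ZMod K.n).val) le_rfl hs
  rw [Function.comp_apply, run_append, run_drawUnits_table K _ ν _ (by omega) h1, PMF.bind_map]
  congr 1; funext w2
  have h2 := hov _ (L + N * m) (fun t => (w2 (finProdFinEquiv.symm t).1
    (finProdFinEquiv.symm t).2 : ZMod K.n).val) (by omega) h1
  rw [Function.comp_apply, run_append, run_drawUnits K _ ν _ (by omega) h2, PMF.bind_map]
  congr 1; funext w3
  have h3 := hov _ (L + 2 * (N * m)) (fun t => (w3 t : ZMod K.n).val) (by omega) h2
  rw [Function.comp_apply, run_append, run_drawResidues K _ ν _ (by omega) h3, PMF.bind_map]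
  congr 1; funext w4
  have h4 := hov _ (L + 2 * (N * m) + m) (fun t => (w4 t).val) (by omega) h3
  rw [Function.comp_apply, run_drawResidues_table K _ ν _ (by omega) h4]
  rfl

/-- Expressions in the inputs and the random choices of a program. -/
abbrev CoinExpr (L N m : ℕ) : Type := Expr (Fin L ⊕ CoinVar N m)

/-- The values of the inputs and of the random choices. -/
def coinEnv (inp : List ℕ) (L : ℕ) {K : Key} (ω : Coins N m K) : Fin L ⊕ CoinVar N m → ℕ :=
  Sum.elim (fun v => inp.getD v 0) ω.env

/-- The program that computes a modulus from its `L` inputs, makes the random choices of the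
protocol for this modulus, and outputs the values of some expressions. -/
def coinProg {L N m : ℕ} (modulus : Expr (Fin L)) (es : List (CoinExpr L N m)) : Prog where
  code := modulus.compile (fun v : Fin L => (v : ℕ)) L ++ (coinCode N m L (L + 1) ++
    Expr.compileList (Sum.elim (fun v : Fin L => (v : ℕ)) (CoinVar.addr (L + 1))) es (L + 1 + coinSize N m))
  out := List.range' (L + 1 + coinSize N m) es.length

theorem coinProg_exec {L : ℕ} (modulus : Expr (Fin L)) (es : List (CoinExpr L N m)) (K : Key)
    (inp : List ℕ) (hmod : (modulus.eval fun v : Fin L => inp.getD v 0) = K.n) :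
    (coinProg modulus es).exec inp =
      (coins N m K).map fun ω => es.map (Expr.eval (coinEnv inp L ω)) := by
  obtain ⟨t, ht, htL, hts⟩ := Expr.run_compile (fun v : Fin L => (v : ℕ))
    (fun v => inp.getD v 0) modulus L (fun i => inp.getD i 0) (fun v => v.isLt) (fun _ => rfl)
  rw [exec_eq, coinProg, run_append, ht, PMF.pure_bind, run_append,
    run_coinCode K t L (L + 1) (by omega) (htL.trans hmod), PMF.bind_map, PMF.map_bind]
  congr 1
  funext ω
  obtain ⟨u, hu, huo, -⟩ := Expr.run_compileList
    (Sum.elim (fun v : Fin L => (v : ℕ)) (CoinVar.addr (L + 1))) (coinEnv inp L ω) es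
    (L + 1 + coinSize N m) (coinState t (L + 1) ω) (by
      rintro (v | c)
      · simp only [Sum.elim_inl]; omega
      · exact c.addr_lt _) (by
      rintro (v | c)
      · simp only [Sum.elim_inl, coinEnv]
        rw [coinState_of_lt _ _ _ (by omega), hts _ v.isLt]
      · exact coinState_addr _ _ _ c)
  rw [Function.comp_apply, hu, PMF.pure_map, huo]
  rfl

end

/-! ### The Paillier cryptosystem -/

theorem natCast_pow_self_congr {n a b : ℕ} (h : (a : ZMod n) = b) :
    (a : ZMod (n ^ 2)) ^ n = (b : ZMod (n ^ 2)) ^ n := by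
  have h1 : (n : ℤ) ∣ (a : ℤ) - b := by
    rw [← ZMod.intCast_zmod_eq_zero_iff_dvd]
    push_cast
    rw [h, sub_self]
  have h2 := dvd_sub_pow_of_dvd_sub h1 1
  have h3 := (ZMod.intCast_zmod_eq_zero_iff_dvd ((a : ℤ) ^ n ^ 1 - (b : ℤ) ^ n ^ 1) (n ^ 2)).2
    (by push_cast; exact h2)
  rw [pow_one] at h3
  push_cast at h3
  exact sub_eq_zero.1 h3

theorem one_add_mul_pow {n : ℕ} (a x : ℕ) :
    (1 + (n : ZMod (n ^ 2)) * a) ^ x = 1 + (n : ZMod (n ^ 2)) * (a * x : ℕ) := by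
  have hn : (n : ZMod (n ^ 2)) * n = 0 := by
    rw [← Nat.cast_mul, ← sq, ZMod.natCast_self]
  induction x with
  | zero => simp
  | succ x ih =>
    rw [pow_succ (1 + (n : ZMod (n ^ 2)) * a) x, ih]
    push_cast
    linear_combination (a * x * a : ZMod (n ^ 2)) * hn

theorem paillierL_one_add_mul {n : ℕ} (hn : 1 < n) (y : ℕ) :
    (paillierL n (1 + (n : ZMod (n ^ 2)) * y) : ZMod n) = y := by
  have h0 : (n : ZMod (n ^ 2)) * n = 0 := by
    rw [← Nat.cast_mul, ← sq, ZMod.natCast_self]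
  have h1 : 1 + (n : ZMod (n ^ 2)) * y = ((1 + n * (y % n) : ℕ) : ZMod (n ^ 2)) := by
    conv_lhs => rw [← Nat.div_add_mod y n]
    push_cast
    linear_combination ((y / n : ℕ) : ZMod (n ^ 2)) * h0
  have hlt : 1 + n * (y % n) < n ^ 2 := by
    have := Nat.mod_lt y (by omega : 0 < n)
    nlinarith
  rw [paillierL, h1, ZMod.val_cast_of_lt hlt, Nat.add_sub_cancel_left,
    Nat.mul_div_cancel_left _ (by omega), ZMod.natCast_mod]

namespace Key

variable (K : Key)

theorem one_lt_n : 1 < K.n := by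
  have := K.prime_p.two_le
  have := K.prime_q.two_le
  show 1 < K.p * K.q
  nlinarith

theorem two_lt_n : 2 < K.n := by
  have := K.prime_p.two_le
  have := K.prime_q.two_le
  show 2 < K.p * K.q
  nlinarith

theorem unit_pow_lam (r : (ZMod K.n)ˣ) : r ^ K.lam = 1 := by
  set a := (r : ZMod K.n).val with ha
  have hc : Nat.Coprime a (K.p * K.q) := ZMod.val_coe_unit_coprime r
  have key : ∀ p : ℕ, p.Prime → Nat.Coprime a p → (p - 1) ∣ K.lam → a ^ K.lam ≡ 1 [MOD p] := by
    rintro p hp hap ⟨c, hcl⟩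
    have := Nat.ModEq.pow_totient hap
    rw [Nat.totient_prime hp] at this
    rw [hcl, pow_mul]
    simpa using this.pow c
  have h1 := key K.p K.prime_p (Nat.Coprime.coprime_mul_right_right hc) (Nat.dvd_lcm_left _ _)
  have h2 := key K.q K.prime_q (Nat.Coprime.coprime_mul_left_right hc) (Nat.dvd_lcm_right _ _)
  have h3 := (Nat.modEq_and_modEq_iff_modEq_mul
    ((Nat.coprime_primes K.prime_p K.prime_q).2 K.ne)).1 ⟨h1, h2⟩
  have h4 := (ZMod.natCast_eq_natCast_iff _ _ K.n).2 h3
  apply Units.ext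
  rw [Units.val_pow_eq_pow_val, Units.val_one, ← ZMod.natCast_zmod_val (r : ZMod K.n)]
  exact_mod_cast h4

/-- The homomorphism `ρ ↦ ρ ^ n` from the units modulo `n` to the units modulo `n²`. -/
def nthPower : (ZMod K.n)ˣ →* (ZMod (K.n ^ 2))ˣ :=
  MonoidHom.toHomUnits
    { toFun := fun r => (((r : ZMod K.n).val : ℕ) : ZMod (K.n ^ 2)) ^ K.n
      map_one' := by
        rw [natCast_pow_self_congr (b := 1) (by simp)]
        simp
      map_mul' := fun r s => by
        rw [← mul_pow, ← Nat.cast_mul]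
        exact natCast_pow_self_congr (by simp) }

theorem nthPower_val (r : (ZMod K.n)ˣ) :
    (K.nthPower r : ZMod (K.n ^ 2)) = (((r : ZMod K.n).val : ℕ) : ZMod (K.n ^ 2)) ^ K.n := rfl

/-- The generator as a unit modulo `n²`. -/
def genUnit : (ZMod (K.n ^ 2))ˣ := K.g

/-- The generator modulo `n`. -/
def genMod : (ZMod K.n)ˣ :=
  Units.map (ZMod.castHom (Dvd.intro_left (K.n ^ 1) rfl : K.n ∣ K.n ^ 2) (ZMod K.n)).toMonoidHom
    K.genUnit

theorem genMod_val : (K.genMod : ZMod K.n) = ((K.gen.val : ℕ) : ZMod K.n) := by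
  show (ZMod.castHom _ (ZMod K.n)) K.gen = _
  conv_lhs => rw [← ZMod.natCast_zmod_val K.gen]
  exact map_natCast _ _

theorem genUnit_pow_n : K.genUnit ^ K.n = K.nthPower K.genMod := by
  apply Units.ext
  rw [nthPower_val, Units.val_pow_eq_pow_val]
  show K.gen ^ K.n = _
  conv_lhs => rw [← ZMod.natCast_zmod_val K.gen]
  apply natCast_pow_self_congr
  rw [ZMod.natCast_zmod_val, genMod_val]

theorem enc_eq (x : ZMod K.n) (r : (ZMod K.n)ˣ) :
    K.enc x r = ((K.genUnit ^ x.val * K.nthPower r : (ZMod (K.n ^ 2))ˣ) : ZMod (K.n ^ 2)) := by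
  rw [Units.val_mul, Units.val_pow_eq_pow_val, nthPower_val]
  rfl

theorem genUnit_zpow_mul (z : ℤ) (r : (ZMod K.n)ˣ) :
    ((K.genUnit ^ z * K.nthPower r : (ZMod (K.n ^ 2))ˣ) : ZMod (K.n ^ 2)) =
      K.enc (z : ZMod K.n) (r * K.genMod ^ (z / (K.n : ℤ))) := by
  rw [enc_eq]
  congr 1
  have h : (((z : ZMod K.n).val : ℕ) : ℤ) = z % (K.n : ℤ) := ZMod.val_intCast z
  rw [map_mul, map_zpow, ← genUnit_pow_n, ← zpow_natCast, h, ← zpow_natCast, ← zpow_mul]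
  conv_lhs => rw [← Int.mul_ediv_add_emod z K.n, zpow_add]
  rw [mul_comm (K.nthPower r), mul_assoc, mul_left_comm]

theorem prod_enc {ι : Type*} [Fintype ι] (x : ι → ZMod K.n) (r : ι → (ZMod K.n)ˣ) :
    ∏ i, K.enc (x i) (r i) = K.enc (∑ i, x i)
      ((∏ i, r i) * K.genMod ^ (((∑ i, (x i).val : ℕ) : ℤ) / (K.n : ℤ))) := by
  have h := K.genUnit_zpow_mul ((∑ i, (x i).val : ℕ) : ℤ) (∏ i, r i)
  have e : (((∑ i, (x i).val : ℕ) : ℤ) : ZMod K.n) = ∑ i, x i := by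
    push_cast
    simp
  rw [e] at h
  rw [← h, zpow_natCast, map_prod, ← Finset.prod_pow_eq_pow_sum, ← Finset.prod_mul_distrib]
  simp only [enc_eq]
  exact (Units.coe_prod _ _).symm

theorem gen_pow_lam : ∃ a : ℕ, K.gen ^ K.lam = 1 + (K.n : ZMod (K.n ^ 2)) * a := by
  set u : ZMod (K.n ^ 2) := K.gen ^ K.lam with hu
  have hn := K.one_lt_n
  have h1 : ((u.val : ℕ) : ZMod K.n) = ((1 : ℕ) : ZMod K.n) := by
    have h2 := congrArg (Units.val) (K.unit_pow_lam K.genMod)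
    rw [Units.val_pow_eq_pow_val, Units.val_one, genMod_val] at h2
    have h3 : ∀ v : ZMod (K.n ^ 2), ((v.val : ℕ) : ZMod K.n) =
        ZMod.castHom (Dvd.intro_left (K.n ^ 1) rfl : K.n ∣ K.n ^ 2) (ZMod K.n) v := fun v => by
      conv_rhs => rw [← ZMod.natCast_zmod_val v]
      exact (map_natCast _ _).symm
    rw [h3] at h2 ⊢
    rw [hu, map_pow, h2, Nat.cast_one]
  have h2 := (ZMod.natCast_eq_natCast_iff' _ _ _).1 h1
  rw [Nat.mod_eq_of_lt hn] at h2
  refine ⟨u.val / K.n, ?_⟩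
  conv_lhs => rw [← ZMod.natCast_zmod_val u, ← Nat.mod_add_div u.val K.n, h2]
  push_cast
  rfl

theorem dec_enc (x : ZMod K.n) (r : (ZMod K.n)ˣ) : K.dec (K.enc x r) = x := by
  obtain ⟨a, ha⟩ := K.gen_pow_lam
  have hn := K.one_lt_n
  have hunit : IsUnit (a : ZMod K.n) := by
    have h := K.isUnit_L
    change IsUnit ((paillierL K.n (K.gen ^ K.lam) : ℕ) : ZMod K.n) at h
    rwa [ha, paillierL_one_add_mul hn] at h
  have h1 : K.enc x r ^ K.lam = 1 + (K.n : ZMod (K.n ^ 2)) * (a * x.val : ℕ) := by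
    rw [enc, mul_pow (K.gen ^ _), pow_right_comm K.gen, ha, one_add_mul_pow,
      ← nthPower_val, ← Units.val_pow_eq_pow_val, ← map_pow, unit_pow_lam, map_one,
      Units.val_one, mul_one]
  rw [dec, h1, ha, paillierL_one_add_mul hn, paillierL_one_add_mul hn]
  obtain ⟨u, hu⟩ := hunit
  rw [Nat.cast_mul, ← hu, ZMod.natCast_zmod_val, mul_right_comm, ZMod.mul_inv_of_unit _ u.isUnit,
    one_mul]

theorem enc_val (x : ZMod K.n) (r : (ZMod K.n)ˣ) :
    (K.enc x r).val = (K.gen.val ^ x.val % K.n ^ 2) *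
      ((r : ZMod K.n).val ^ K.n % K.n ^ 2) % K.n ^ 2 := by
  have h : K.enc x r = ((K.gen.val ^ x.val * (r : ZMod K.n).val ^ K.n : ℕ) : ZMod (K.n ^ 2)) := by
    push_cast
    rw [ZMod.natCast_zmod_val]
    rfl
  rw [h, ZMod.val_natCast, Nat.mul_mod]

end Key

/-! ### Correctness of the protocol -/

section

variable {N m : ℕ} (f : ℕ → ℕ) (S : ℕ) (K : Key) (b : Fin N → Fin m → Bool) (ω : Coins N m K)

theorem natCast_toNat_val (c : Bool) : ((c.toNat : ZMod K.n)).val = c.toNat :=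
  ZMod.val_cast_of_lt ((Bool.toNat_lt c).trans K.two_lt_n)

theorem bitCipher_eq (i : Fin N) (j : Fin m) :
    bitCipher K b ω i j =
      ((K.genUnit ^ (b i j).toNat * K.nthPower (ω.r1 i j) : (ZMod (K.n ^ 2))ˣ) :
        ZMod (K.n ^ 2)) := by
  rw [bitCipher, Key.enc_eq, natCast_toNat_val]

/-- The integer that is encrypted, up to multiples of `n`, in the reply to user `i`. -/
def replyExponent (i : Fin N) (j : Fin m) : ℤ :=
  (usersAt b j : ℤ) + (ω.R j).val - (b i j).toNat * (ω.R j).val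

/-- The randomness of the reply to user `i`. -/
def replyRandomness (i : Fin N) (j : Fin m) : (ZMod K.n)ˣ :=
  (∏ i', ω.r1 i' j) * ω.rOp j * (ω.r1 i j ^ (ω.R j).val)⁻¹ *
    K.genMod ^ (replyExponent K b ω i j / (K.n : ℤ))

theorem replyCipher_eq (i : Fin N) (j : Fin m) :
    replyCipher K b ω i j = K.enc (replyExponent K b ω i j : ZMod K.n)
      (replyRandomness K b ω i j) := by
  rw [replyRandomness, ← Key.genUnit_zpow_mul, replyCipher, Key.enc_eq]
  simp only [bitCipher_eq]
  rw [← Units.coe_prod, ← Units.val_pow_eq_pow_val, ZMod.inv_coe_unit, ← Units.val_mul,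
    ← Units.val_mul]
  congr 1
  rw [Finset.prod_mul_distrib, Finset.prod_pow_eq_pow_sum, replyExponent, zpow_sub, zpow_add,
    zpow_natCast, zpow_natCast, ← Nat.cast_mul, zpow_natCast, map_mul, map_mul, map_inv, map_pow,
    map_prod, mul_pow (K.genUnit ^ _),
    ← pow_mul K.genUnit, mul_inv, usersAt]
  rw [mul_mul_mul_comm (_ ^ _), mul_mul_mul_comm (_ * _)]

theorem replyExponent_cast (i : Fin N) (j : Fin m) :
    (replyExponent K b ω i j : ZMod K.n) =
      if b i j then (usersAt b j : ZMod K.n) else usersAt b j + ω.R j := by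
  rw [replyExponent]
  push_cast
  rw [ZMod.natCast_zmod_val]
  cases b i j <;> simp

theorem decrypted_eq (i : Fin N) (j : Fin m) (h : b i j = true) :
    decrypted K b ω i j = decode (usersAt b j : ZMod K.n) := by
  rw [decrypted, replyCipher_eq, Key.dec_enc, replyExponent_cast, if_pos h]

theorem decode_natCast {n x : ℕ} [NeZero n] (h : 2 * x < n) : decode (x : ZMod n) = x := by
  rw [decode, ZMod.valMinAbs_natCast_of_le_half (by omega), Int.toNat_natCast]

theorem usersAt_le (j : Fin m) : usersAt b j ≤ N := by
  have h : ∀ i ∈ Finset.univ, (b i j).toNat ≤ 1 := fun i _ => Bool.toNat_le _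
  simpa [usersAt] using Finset.sum_le_card_nsmul Finset.univ _ 1 h

theorem userOutput_eq (hn : 2 * N < K.n) (i : Fin N) (j : Fin m) :
    userOutput K b ω i j = userShare b i j := by
  unfold userOutput userShare
  split_ifs with h
  · have := usersAt_le b j
    rw [decrypted_eq K b ω i j h, decode_natCast (by omega)]
  · rfl

/-- What user `i` contributes to the sum over all users, without the mask, if his decryption is
`x`. -/
def contribution (x : ℕ) (c : Bool) : ℕ := if c then S * f x / x else 0

theorem shareCipher_eq (i : Fin N) (j : Fin m) :
    shareCipher f S K b ω i j =
      K.enc ((contribution f S (decode (usersAt b j : ZMod K.n)) (b i j) : ZMod K.n) +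
        ω.mask i j) (ω.r2 i j) := by
  unfold shareCipher contribution
  by_cases h : b i j = true
  · simp only [h, if_true, decrypted_eq K b ω i j h]
  · simp [h]

theorem productCipher_eq (j : Fin m) :
    productCipher f S K b ω j = K.enc
      (∑ i, ((contribution f S (decode (usersAt b j : ZMod K.n)) (b i j) : ZMod K.n) +
        ω.mask i j))
      ((∏ i, ω.r2 i j) * K.genMod ^ (((∑ i, ((contribution f S
        (decode (usersAt b j : ZMod K.n)) (b i j) : ZMod K.n) + ω.mask i j).val : ℕ) : ℤ) /
          (K.n : ℤ))) := by
  unfold productCipher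
  simp only [shareCipher_eq]
  exact K.prod_enc _ _

theorem sum_contribution (hf0 : f 0 = 0)
    (hround : ∀ x, 1 ≤ x → x ≤ N → x ∣ S * f x) (j : Fin m) :
    ∑ i, contribution f S (usersAt b j) (b i j) = S * f (usersAt b j) := by
  have h : ∀ i, contribution f S (usersAt b j) (b i j) =
      (b i j).toNat * (S * f (usersAt b j) / usersAt b j) := fun i => by
    unfold contribution
    cases b i j <;> simp
  simp only [h]
  rw [← Finset.sum_mul]
  change usersAt b j * _ = _
  rcases Nat.eq_zero_or_pos (usersAt b j) with h0 | h0
  · rw [h0, hf0]; simp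
  · exact Nat.mul_div_cancel' (hround _ h0 (usersAt_le b j))

theorem aggregate_eq (hf0 : f 0 = 0) (hround : ∀ x, 1 ≤ x → x ≤ N → x ∣ S * f x)
    (hn : 2 * N < K.n) (j : Fin m) :
    aggregate f S K b ω j = (S * f (usersAt b j) : ℕ) + ∑ i, ω.mask i j := by
  have := usersAt_le b j
  rw [aggregate, productCipher_eq, Key.dec_enc, Finset.sum_add_distrib,
    decode_natCast (by omega), ← Nat.cast_sum, sum_contribution f S b hf0 hround]

theorem operatorOutput_eq {r : ℕ} (hS : 0 < S) (hf0 : f 0 = 0) (hfr : ∀ x, f x ≤ r)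
    (hround : ∀ x, 1 ≤ x → x ≤ N → x ∣ S * f x)
    (hn : 2 * N < K.n) (hn' : 2 * (S * r) < K.n) (j : Fin m) :
    operatorOutput f S K b ω j = f (usersAt b j) := by
  have := Nat.mul_le_mul_left S (hfr (usersAt b j))
  rw [operatorOutput, aggregate_eq f S K b ω hf0 hround hn, add_sub_cancel_right,
    decode_natCast (by omega), Nat.mul_div_cancel_left _ hS]

end

/-! ### Expressions for ciphertexts -/

/-- The expression for an encryption of `x` with the random number `r`. -/
def encExpr {V : Type} (n g x r : Expr V) : Expr V :=
  .mod (.mul (.powMod g x (.mul n n)) (.powMod r n (.mul n n))) (.mul n n)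

theorem encExpr_eval {V : Type} (K : Key) (env : V → ℕ) (n g x r : Expr V) (y : ZMod K.n)
    (ρ : (ZMod K.n)ˣ) (hn : n.eval env = K.n) (hg : g.eval env = K.gen.val)
    (hx : x.eval env = y.val) (hr : r.eval env = (ρ : ZMod K.n).val) :
    (encExpr n g x r).eval env = (K.enc y ρ).val := by
  have h0 : K.n * K.n ≠ 0 := mul_ne_zero (NeZero.ne _) (NeZero.ne _)
  simp only [encExpr, Expr.eval, hn, hg, hx, hr, if_neg h0, Key.enc_val, sq]

theorem getD_append_ofFn (l : List ℕ) {m : ℕ} (F : Fin m → ℕ) (l' : List ℕ) (j : Fin m) (x : ℕ)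
    (hx : x = l.length + j) : (l ++ List.ofFn F ++ l').getD x 0 = F j := by
  subst hx
  rw [List.getD_append _ _ _ _ (by simp), List.getD_append_right _ _ _ _ (by omega),
    List.getD_eq_getElem _ _ (by simp)]
  simp

@[to_additive]
theorem eq_of_prod_eq {ι M : Type*} [Fintype ι] [DecidableEq ι] [CommGroup M] {x y : ι → M}
    (i₀ : ι) (h : ∀ i, i ≠ i₀ → x i = y i) (hp : ∏ i, x i = ∏ i, y i) : x = y := by
  funext i
  by_cases hi : i = i₀
  · subst hi
    rw [← Finset.mul_prod_erase _ _ (Finset.mem_univ i),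
      ← Finset.mul_prod_erase _ y (Finset.mem_univ i),
      Finset.prod_congr rfl fun i' hi' => h i' (Finset.ne_of_mem_erase hi')] at hp
    exact mul_right_cancel hp
  · exact h i hi

section

variable {N m : ℕ} (f : ℕ → ℕ) (S : ℕ)

/-! ### The simulator of a user -/

section

variable (K : Key) (b : Fin N → Fin m → Bool)

/-- The plaintext of a share. -/
def sharePlain (mask : Fin N → Fin m → ZMod K.n) (i : Fin N) (j : Fin m) : ZMod K.n :=
  (contribution f S (decode (usersAt b j : ZMod K.n)) (b i j) : ZMod K.n) + mask i j

/-- The random choices with the randomness of the operator replaced by the randomness of his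
replies to user `i`, with his plaintexts replaced by those of the replies where these are not
determined by the input of `i`, and with the choices that concern the user `i₀` (if there is one)
in Stage 2 replaced by plaintexts and randomness of the products. -/
def reparam (i : Fin N) (i₀ : Option (Fin N)) (ω : Coins N m K) : Coins N m K :=
  (ω.r1,
    i₀.elim ω.r2 fun i' => Function.update ω.r2 i' fun j => (∏ i, ω.r2 i j) *
      K.genMod ^ (((∑ i, (sharePlain f S K b ω.mask i j).val : ℕ) : ℤ) / (K.n : ℤ)),
    replyRandomness K b ω i,
    fun j => if b i j then ω.R j else usersAt b j + ω.R j,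
    i₀.elim ω.mask fun i' => Function.update ω.mask i' fun j =>
      ∑ i, sharePlain f S K b ω.mask i j)

theorem reparam_injective (i : Fin N) (i₀ : Option (Fin N)) :
    Function.Injective (reparam f S K b i i₀) := by
  rintro ⟨r1, r2, rOp, R, mask⟩ ⟨r1', r2', rOp', R', mask'⟩ h
  simp only [reparam, Prod.mk.injEq] at h
  obtain ⟨h1, h2, h3, h4, h5⟩ := h
  change r1 = r1' at h1
  subst h1
  have hR : R = R' := by
    funext j
    have := congrFun h4 j
    change (if b i j then R j else _ + R j) = if b i j then R' j else _ + R' j at this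
    split_ifs at this
    · exact this
    · exact add_left_cancel this
  subst hR
  have hOp : rOp = rOp' := by
    funext j
    have := congrFun h3 j
    exact mul_left_cancel (mul_right_cancel (mul_right_cancel this))
  subst hOp
  cases i₀ with
  | none =>
    change r2 = r2' at h2
    change mask = mask' at h5
    rw [h2, h5]
  | some i₀ =>
    change Function.update mask i₀ _ = Function.update mask' i₀ _ at h5
    change Function.update r2 i₀ _ = Function.update r2' i₀ _ at h2
    have hm : mask = mask' := by
      have h6 : ∀ j, (fun i => mask i j) = fun i => mask' i j := fun j => by
        refine eq_of_sum_eq i₀ (fun i hi => ?_) ?_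
        · have := congrFun (congrFun h5 i) j
          rwa [Function.update_of_ne hi, Function.update_of_ne hi] at this
        · have := congrFun (congrFun h5 i₀) j
          rw [Function.update_self, Function.update_self] at this
          change ∑ i, (_ + mask i j) = ∑ i, (_ + mask' i j) at this
          rw [Finset.sum_add_distrib, Finset.sum_add_distrib] at this
          exact add_left_cancel this
      funext i j
      exact congrFun (h6 j) i
    subst hm
    have hr : r2 = r2' := by
      have h6 : ∀ j, (fun i => r2 i j) = fun i => r2' i j := fun j => by
        refine eq_of_prod_eq i₀ (fun i hi => ?_) ?_
        · have := congrFun (congrFun h2 i) j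
          rwa [Function.update_of_ne hi, Function.update_of_ne hi] at this
        · have := congrFun (congrFun h2 i₀) j
          rw [Function.update_self, Function.update_self] at this
          exact mul_right_cancel this
      funext i j
      exact congrFun (h6 j) i
    rw [hr]

/-- The product ciphertext in terms of the new random choices. -/
def simProduct (i : Fin N) (i₀ : Option (Fin N)) (ω : Coins N m K) (j : Fin m) :
    ZMod (K.n ^ 2) :=
  i₀.elim (K.enc ((contribution f S 1 (b i j) : ZMod K.n) + ω.mask i j) (ω.r2 i j))
    fun i' => K.enc (ω.mask i' j) (ω.r2 i' j)

/-- The view of user `i` in terms of the new random choices. -/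
def simUserView (i : Fin N) (i₀ : Option (Fin N)) (ω : Coins N m K) : List ℕ :=
  K.priv ++
  List.ofFn (fun j => (b i j).toNat) ++
  List.ofFn (fun j => (ω.r1 i j : ZMod K.n).val) ++
  List.ofFn (fun j => (ω.r2 i j : ZMod K.n).val) ++
  List.ofFn (fun j => (K.enc (if b i j then (usersAt b j : ZMod K.n) else ω.R j)
    (ω.rOp j)).val) ++
  List.ofFn (fun j => (ω.mask i j).val) ++
  List.ofFn (fun j => (simProduct f S K b i i₀ ω j).val)

theorem userView_eq (i : Fin N) (i₀ : Option (Fin N))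
    (h : i₀.elim (∀ i', i' = i) fun i' => i' ≠ i) (ω : Coins N m K) :
    userView f S K b ω i = simUserView f S K b i i₀ (reparam f S K b i i₀ ω) := by
  have hr2 : (reparam f S K b i i₀ ω).r2 i = ω.r2 i := by
    cases i₀ with
    | none => rfl
    | some i' => exact Function.update_of_ne (Ne.symm h) _ _
  have hmask : (reparam f S K b i i₀ ω).mask i = ω.mask i := by
    cases i₀ with
    | none => rfl
    | some i' => exact Function.update_of_ne (Ne.symm h) _ _
  have hreply : ∀ j, replyCipher K b ω i j = K.enc (if b i j then (usersAt b j : ZMod K.n)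
      else (reparam f S K b i i₀ ω).R j) ((reparam f S K b i i₀ ω).rOp j) := fun j => by
    rw [replyCipher_eq, replyExponent_cast]
    congr 1
    change _ = if b i j then _ else if b i j then _ else _
    split_ifs <;> rfl
  have hprod : ∀ j, productCipher f S K b ω j =
      simProduct f S K b i i₀ (reparam f S K b i i₀ ω) j := fun j => by
    cases i₀ with
    | none =>
      have hi : ∀ F : Fin N → ZMod (K.n ^ 2), ∏ i', F i' = F i := fun F =>
        Finset.prod_eq_single i (fun i' _ hi' => absurd (h i') hi')
          (fun hi => absurd (Finset.mem_univ i) hi)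
      have hu : usersAt b j = (b i j).toNat :=
        Finset.sum_eq_single i (fun i' _ hi' => absurd (h i') hi')
          (fun hi => absurd (Finset.mem_univ i) hi)
      rw [productCipher, hi, shareCipher_eq, hu]
      change _ = K.enc (_ + ω.mask i j) (ω.r2 i j)
      congr 2
      cases b i j with
      | false => simp [contribution]
      | true =>
        rw [Bool.toNat_true, decode_natCast K.two_lt_n]
    | some i' =>
      rw [productCipher_eq]
      change _ = K.enc (Function.update ω.mask i' _ i' j) (Function.update ω.r2 i' _ i' j)
      rw [Function.update_self, Function.update_self]
      rfl
  simp only [userView, simUserView, hreply, hprod, hr2, hmask]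
  rfl

end

/-- The expressions that make up the simulated view of a user. -/
def userExprs (i : Fin N) (i₀ : Option (Fin N)) : List (CoinExpr (3 + m + m) N m) :=
  let p : CoinExpr (3 + m + m) N m := .var (.inl ⟨0, by omega⟩)
  let q : CoinExpr (3 + m + m) N m := .var (.inl ⟨1, by omega⟩)
  let g : CoinExpr (3 + m + m) N m := .var (.inl ⟨2, by omega⟩)
  let b : Fin m → CoinExpr (3 + m + m) N m := fun j => .var (.inl ⟨3 + j, by omega⟩)
  let a : Fin m → CoinExpr (3 + m + m) N m := fun j => .var (.inl ⟨3 + m + j, by omega⟩)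
  let n := Expr.mul p q
  let coin : CoinVar N m → CoinExpr (3 + m + m) N m := fun c => .var (.inr c)
  [p, q, g] ++
  List.ofFn b ++
  List.ofFn (fun j => coin (.r1 i j)) ++
  List.ofFn (fun j => coin (.r2 i j)) ++
  List.ofFn (fun j => encExpr n g
    (.mod (.add (a j) (.mul (.sub (.const 1) (b j)) (coin (.R j)))) n) (coin (.rOp j))) ++
  List.ofFn (fun j => coin (.mask i j)) ++
  List.ofFn (fun j => i₀.elim
    (encExpr n g (.mod (.add (.mul (b j) (.const (S * f 1))) (coin (.mask i j))) n)
      (coin (.r2 i j)))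
    fun i' => encExpr n g (coin (.mask i' j)) (coin (.r2 i' j)))

theorem userExprs_eval (K : Key) (b : Fin N → Fin m → Bool) (i : Fin N) (i₀ : Option (Fin N))
    (ω : Coins N m K) :
    (userExprs f S i i₀).map (Expr.eval (coinEnv (userLeak K b i) (3 + m + m) ω)) =
      simUserView f S K b i i₀ ω := by
  have hp : (userLeak K b i).getD 0 0 = K.p := rfl
  have hq : (userLeak K b i).getD 1 0 = K.q := rfl
  have hg : (userLeak K b i).getD 2 0 = K.gen.val := rfl
  have hb : ∀ j : Fin m, (userLeak K b i).getD (3 + j) 0 = (b i j).toNat := fun j =>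
    getD_append_ofFn K.priv (fun j => (b i j).toNat) _ j _ rfl
  have ha : ∀ j : Fin m, (userLeak K b i).getD (3 + m + j) 0 = (userShare b i j).getD 0 :=
    fun j => by
      rw [← List.append_nil (userLeak K b i)]
      exact getD_append_ofFn _ (fun j => (userShare b i j).getD 0) _ j _ (by
        simp [Key.priv]; omega)
  generalize hinp : userLeak K b i = inp at *
  have hn : (Expr.mul (.var (.inl ⟨0, by omega⟩)) (.var (.inl ⟨1, by omega⟩)) :
      CoinExpr (3 + m + m) N m).eval (coinEnv inp (3 + m + m) ω) = K.n := by
    simp only [Expr.eval, coinEnv, Sum.elim_inl, hp, hq]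
  have hG : (Expr.var (.inl ⟨2, by omega⟩) :
      CoinExpr (3 + m + m) N m).eval (coinEnv inp (3 + m + m) ω) = K.gen.val := by
    simp only [Expr.eval, coinEnv, Sum.elim_inl, hg]
  simp only [userExprs, simUserView, List.map_append, List.map_ofFn, Function.comp_def]
  congr 1
  · congr 1
    · congr 1
      · congr 1
        · congr 1
          · congr 1
            · simp only [List.map_cons, List.map_nil, Expr.eval, coinEnv, Sum.elim_inl, hp, hq, hg]
              rfl
            · simp only [Expr.eval, coinEnv, Sum.elim_inl, hb]
      · congr 1
        funext j
        refine encExpr_eval K _ _ _ _ _ _ _ hn hG ?_ rfl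
        rw [Expr.eval, hn]
        simp only [Expr.eval, coinEnv, Sum.elim_inl, Sum.elim_inr, ha, hb, Coins.env, userShare]
        cases b i j
        · simp [Nat.mod_eq_of_lt (ZMod.val_lt (ω.R j))]
        · simp [ZMod.val_natCast]
  · congr 1
    funext j
    cases i₀ with
    | none =>
      refine encExpr_eval K _ _ _ _ _ _ _ hn hG ?_ rfl
      rw [Expr.eval, hn]
      simp only [Expr.eval, coinEnv, Sum.elim_inl, Sum.elim_inr, hb, Coins.env, contribution]
      cases b i j
      · simp [Nat.mod_eq_of_lt (ZMod.val_lt (ω.mask i j))]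
      · simp [ZMod.val_add, ZMod.val_natCast, ZMod.val_mul]
    | some i' => exact encExpr_eval K _ _ _ _ _ _ _ hn hG rfl rfl

theorem exists_user_simulator (i : Fin N) : ∃ Sim : Prog, Sim.IsPPT ∧
    ∀ (K : Key) (b : Fin N → Fin m → Bool),
      (coins N m K).map (fun ω => userView f S K b ω i) = Sim.exec (userLeak K b i) := by
  obtain ⟨i₀, hi₀⟩ : ∃ i₀ : Option (Fin N), i₀.elim (∀ i', i' = i) fun i' => i' ≠ i := by
    by_cases h : ∀ i', i' = i
    · exact ⟨none, h⟩
    · push Not at h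
      obtain ⟨i', hi'⟩ := h
      exact ⟨some i', hi'⟩
  refine ⟨coinProg (L := 3 + m + m) (.mul (.var ⟨0, by omega⟩) (.var ⟨1, by omega⟩)) (userExprs (m := m) f S i i₀),
    Prog.isPPT _, fun K b => ?_⟩
  rw [coinProg_exec _ _ K _ rfl]
  simp only [userExprs_eval, userView_eq f S K b i i₀ hi₀]
  have hbij : Function.Bijective (reparam f S K b i i₀) :=
    Finite.injective_iff_bijective.1 (reparam_injective f S K b i i₀)
  conv_rhs => rw [coins, ← uniform_map_bijective _ hbij, PMF.map_comp]
  rfl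

end

section

/-! ### Rearranging registers -/

/-- Code that copies the registers `src t` to the registers `base + t`; register `z` holds `0`. -/
def copyBlock (base : ℕ) (src : ℕ → ℕ) (z T : ℕ) : List Instr :=
  (List.range T).map fun t => .add (base + t) (src t) z

theorem run_copyBlock (base : ℕ) (src : ℕ → ℕ) (z T : ℕ) (s : ℕ → ℕ)
    (hsrc : ∀ t < T, src t < base ∨ base + T ≤ src t) (hz : z < base ∨ base + T ≤ z)
    (hs : s z = 0) :
    run (copyBlock base src z T) s =
      PMF.pure (overlay s base fun t : Fin T => s (src t)) := by
  induction T with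
  | zero => simp [copyBlock, run_nil, overlay_zero]
  | succ T ih =>
    have hne : ∀ x, (x < base ∨ base + (T + 1) ≤ x) →
        overlay s base (fun t : Fin T => s (src t)) x = s x := by
      rintro x (hx | hx)
      · exact overlay_of_lt _ _ hx
      · exact overlay_of_ge _ _ (by omega)
    have ih' := ih (fun t ht => (hsrc t (by omega)).imp_right (by omega)) (by omega)
    unfold copyBlock at ih' ⊢
    rw [List.range_succ, List.map_append, run_append, ih', PMF.pure_bind, List.map_cons,
      List.map_nil, run_singleton, Instr.eval, PMF.pure_map, hne z hz,
      hne _ (hsrc T (by omega)), hs, add_zero, Instr.dst, ← overlay_snoc]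
    rfl

/-- Code that replaces a list of length `L` in the first registers by the list of its entries at
the given positions. -/
def rearrangeCode (idx : List ℕ) (L : ℕ) : List Instr :=
  copyBlock L (fun t => idx.getD t 0) (L + idx.length) idx.length ++
    (copyBlock 0 (fun t => L + t) (L + idx.length) idx.length ++
      copyBlock idx.length (fun _ => L + idx.length) (L + idx.length) L)

theorem run_rearrangeCode (idx : List ℕ) (s : ℕ → ℕ) (L : ℕ) (hs : ∀ x, L ≤ x → s x = 0)
    (hidx : ∀ x ∈ idx, x < L) (hlen : idx.length ≤ L) :
    run (rearrangeCode idx L) s = PMF.pure fun x => (idx.map s).getD x 0 := by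
  have hsrc : ∀ t < idx.length, idx.getD t 0 < L ∨ L + idx.length ≤ idx.getD t 0 := fun t ht => by
    left
    rw [List.getD_eq_getElem _ _ ht]
    exact hidx _ (List.getElem_mem ht)
  set s₁ := overlay s L fun t : Fin idx.length => s (idx.getD t 0) with hs₁
  set s₂ := overlay s₁ 0 fun t : Fin idx.length => s₁ (L + t) with hs₂
  have h₁ : ∀ x, L + idx.length ≤ x → s₁ x = 0 := fun x hx => by
    rw [hs₁, overlay_of_ge _ _ hx, hs x (by omega)]
  have h₂ : ∀ x, L + idx.length ≤ x → s₂ x = 0 := fun x hx => by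
    rw [hs₂, overlay_of_ge _ _ (by omega), h₁ x hx]
  rw [rearrangeCode, run_append, run_copyBlock _ _ _ _ _ hsrc (by omega) (hs _ (by omega)),
    PMF.pure_bind, run_append,
    run_copyBlock _ _ _ _ _ (fun t ht => by omega) (by omega) (h₁ _ le_rfl), PMF.pure_bind,
    run_copyBlock _ _ _ _ _ (fun t ht => by omega) (by omega) (h₂ _ le_rfl)]
  congr 1
  funext x
  simp only [h₂ _ le_rfl]
  by_cases hx : x < idx.length
  · have hx₂ : s₂ x = s₁ (L + x) := by
      have := overlay_at (L := 0) s₁ (fun t : Fin idx.length => s₁ (L + t)) ⟨x, hx⟩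
      rwa [zero_add] at this
    have hx₁ : s₁ (L + x) = s (idx.getD x 0) :=
      overlay_at s (fun t : Fin idx.length => s (idx.getD t 0)) ⟨x, hx⟩
    rw [overlay_of_lt _ _ hx, hx₂, hx₁, List.getD_eq_getElem (idx.map s) _ (by simpa using hx),
      List.getElem_map, List.getD_eq_getElem idx _ hx]
  · rw [List.getD_eq_default _ _ (by simpa using hx)]
    unfold overlay
    split_ifs
    · rfl
    · exact h₂ x (by omega)

theorem exec_prepend (l : List Instr) (D : Prog) (inp inp' : List ℕ)
    (h : run l (fun i => inp.getD i 0) = PMF.pure fun i => inp'.getD i 0) :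
    Prog.exec ⟨l ++ D.code, D.out⟩ inp = D.exec inp' := by
  rw [exec_eq, exec_eq, run_append, h, PMF.pure_bind]

/-! ### Hybrid views of the operator -/

/-- The entries of the view of the operator. -/
inductive Entry (N m : ℕ) where
  | n
  | g
  | rOp (j : Fin m)
  | R (j : Fin m)
  | mask (i : Fin N) (j : Fin m)
  | cipher (stage : Bool) (i : Fin N) (j : Fin m)
  | agg (j : Fin m)

/-- The view of the operator as a list of names. -/
def entries (N m : ℕ) : List (Entry N m) :=
  [.n, .g] ++ List.ofFn (fun j => .rOp j) ++ List.ofFn (fun j => .R j) ++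
  (List.ofFn fun i => List.ofFn fun j => Entry.mask i j).flatten ++
  (List.ofFn fun i => List.ofFn fun j => Entry.cipher false i j).flatten ++
  (List.ofFn fun i => List.ofFn fun j => Entry.cipher true i j).flatten ++
  (List.ofFn fun _ : Fin N => List.ofFn fun j => Entry.agg j).flatten

variable {N m : ℕ}

/-- The random numbers of the encryptions by the users in Stage 1 (`false`) and 2 (`true`). -/
def Coins.rand {K : Key} (ω : Coins N m K) : Bool → Fin N → Fin m → (ZMod K.n)ˣ
  | false => ω.r1
  | true => ω.r2

/-- Replace the random number of one encryption. -/
def Coins.setRand {K : Key} (s : Bool) (i : Fin N) (j : Fin m) (ω : Coins N m K)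
    (ρ : (ZMod K.n)ˣ) : Coins N m K :=
  match s with
  | false => (Function.update ω.r1 i (Function.update (ω.r1 i) j ρ), ω.2)
  | true => (ω.1, Function.update ω.r2 i (Function.update (ω.r2 i) j ρ), ω.2.2)

theorem Coins.rand_setRand_self {K : Key} (s : Bool) (i : Fin N) (j : Fin m) (ω : Coins N m K)
    (ρ : (ZMod K.n)ˣ) : (ω.setRand s i j ρ).rand s i j = ρ := by
  cases s <;> simp [Coins.setRand, Coins.rand, Coins.r1, Coins.r2]

theorem Coins.rand_setRand_of_ne {K : Key} (s s' : Bool) (i i' : Fin N) (j j' : Fin m)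
    (ω : Coins N m K) (ρ : (ZMod K.n)ˣ) (h : ¬(s' = s ∧ i' = i ∧ j' = j)) :
    (ω.setRand s i j ρ).rand s' i' j' = ω.rand s' i' j' := by
  cases s <;> cases s' <;> simp only [Coins.setRand, Coins.rand, Coins.r1, Coins.r2]
  all_goals
    by_cases hi : i' = i
    · subst hi
      rw [Function.update_self, Function.update_of_ne (by tauto)]
    · rw [Function.update_of_ne hi]

theorem Coins.setRand_rand {K : Key} (s : Bool) (i : Fin N) (j : Fin m) (ω : Coins N m K) :
    ω.setRand s i j (ω.rand s i j) = ω := by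
  cases s <;> simp [Coins.setRand, Coins.rand, Coins.r1, Coins.r2]

theorem Coins.setRand_setRand {K : Key} (s : Bool) (i : Fin N) (j : Fin m) (ω : Coins N m K)
    (ρ ρ' : (ZMod K.n)ˣ) :
    (ω.setRand s i j ρ).setRand s i j ρ' = ω.setRand s i j ρ' := by
  cases s <;> simp [Coins.setRand, Coins.r1, Coins.r2]

/-- The plaintexts that are encrypted in a hybrid view: the masks plus the given numbers. -/
def hybridPlain (K : Key) (d : Bool → Fin N → Fin m → ℕ) (ω : Coins N m K) (s : Bool)
    (i : Fin N) (j : Fin m) : ZMod K.n :=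
  (d s i j : ZMod K.n) + if s then ω.mask i j else 0

/-- The value of an entry in a hybrid view, for the given scaled classes `F`. -/
def hybridValue (K : Key) (F : Fin m → ℕ) (d : Bool → Fin N → Fin m → ℕ) (ω : Coins N m K) :
    Entry N m → ℕ
  | .n => K.n
  | .g => K.gen.val
  | .rOp j => (ω.rOp j : ZMod K.n).val
  | .R j => (ω.R j).val
  | .mask i j => (ω.mask i j).val
  | .cipher s i j => (K.enc (hybridPlain K d ω s i j) (ω.rand s i j)).val
  | .agg j => ((F j : ZMod K.n) + ∑ i, ω.mask i j).val

def hybridView (K : Key) (F : Fin m → ℕ) (d : Bool → Fin N → Fin m → ℕ) (ω : Coins N m K) :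
    List ℕ := (entries N m).map (hybridValue K F d ω)

/-- The numbers that are encrypted in the protocol, without the masks. -/
def realSummand (f : ℕ → ℕ) (S : ℕ) (b : Fin N → Fin m → Bool) :
    Bool → Fin N → Fin m → ℕ
  | false => fun i j => (b i j).toNat
  | true => fun i j => contribution f S (usersAt b j) (b i j)

theorem operatorView_eq (f : ℕ → ℕ) (S : ℕ) (K : Key) (b : Fin N → Fin m → Bool)
    (ω : Coins N m K) (hf0 : f 0 = 0) (hround : ∀ x, 1 ≤ x → x ≤ N → x ∣ S * f x)
    (hn : 2 * N < K.n) :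
    operatorView f S K b ω =
      hybridView K (fun j => S * f (usersAt b j)) (realSummand f S b) ω := by
  have h1 : ∀ i j, bitCipher K b ω i j =
      K.enc (hybridPlain K (realSummand f S b) ω false i j) (ω.r1 i j) := fun i j => by
    simp [bitCipher, hybridPlain, realSummand]
  have h2 : ∀ i j, shareCipher f S K b ω i j =
      K.enc (hybridPlain K (realSummand f S b) ω true i j) (ω.r2 i j) := fun i j => by
    have := usersAt_le b j
    rw [shareCipher_eq, decode_natCast (by omega)]
    simp [hybridPlain, realSummand]
  simp only [operatorView, h1, h2, aggregate_eq f S K b ω hf0 hround hn, hybridView, entries,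
    List.map_append, List.map_ofFn, List.map_flatten, flat, Function.comp_def]
  rfl

theorem hybridValue_setRand (K : Key) (F : Fin m → ℕ) (d d' : Bool → Fin N → Fin m → ℕ)
    (s : Bool) (i : Fin N) (j : Fin m)
    (hd : ∀ s' i' j', ¬(s' = s ∧ i' = i ∧ j' = j) → d s' i' j' = d' s' i' j')
    (ω : Coins N m K) (ρ : (ZMod K.n)ˣ) (e : Entry N m) :
    hybridValue K F d (ω.setRand s i j ρ) e =
      open Classical in if e = .cipher s i j then (K.enc (hybridPlain K d ω s i j) ρ).val
        else hybridValue K F d' ω e := by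
  have hm : (ω.setRand s i j ρ).mask = ω.mask := by cases s <;> rfl
  have ho : (ω.setRand s i j ρ).rOp = ω.rOp := by cases s <;> rfl
  have hR : (ω.setRand s i j ρ).R = ω.R := by cases s <;> rfl
  by_cases he : e = .cipher s i j
  · rw [if_pos he, he]
    simp only [hybridValue, hybridPlain, hm, Coins.rand_setRand_self]
  · rw [if_neg he]
    cases e with
    | cipher s' i' j' =>
      have hne : ¬(s' = s ∧ i' = i ∧ j' = j) := fun ⟨h1, h2, h3⟩ => he (by rw [h1, h2, h3])
      simp only [hybridValue, hybridPlain, hm, Coins.rand_setRand_of_ne _ _ _ _ _ _ _ _ hne,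
        hd _ _ _ hne]
    | _ => simp only [hybridValue, hm, ho, hR]

/-! ### Programs for the hybrid views -/

def sumExpr {V : Type} : List (Expr V) → Expr V
  | [] => .const 0
  | e :: es => .add e (sumExpr es)

theorem sumExpr_eval {V : Type} (env : V → ℕ) (es : List (Expr V)) :
    (sumExpr es).eval env = (es.map (Expr.eval env)).sum := by
  induction es with
  | nil => rfl
  | cons e es ih => rw [sumExpr, Expr.eval, ih, List.map_cons, List.sum_cons]

/-- The expression for a plaintext of a hybrid view. -/
def plainExpr {L : ℕ} (n : CoinExpr L N m) (d : Bool → Fin N → Fin m → ℕ) (s : Bool)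
    (i : Fin N) (j : Fin m) : CoinExpr L N m :=
  .mod (.add (.const (d s i j)) (if s then .var (.inr (.mask i j)) else .const 0)) n

/-- The expression for an entry of a hybrid view. -/
def entryExpr {L : ℕ} (n g : CoinExpr L N m) (F : Fin m → CoinExpr L N m)
    (d : Bool → Fin N → Fin m → ℕ) : Entry N m → CoinExpr L N m
  | .n => n
  | .g => g
  | .rOp j => .var (.inr (.rOp j))
  | .R j => .var (.inr (.R j))
  | .mask i j => .var (.inr (.mask i j))
  | .cipher s i j => encExpr n g (plainExpr n d s i j)
      (.var (.inr (if s then .r2 i j else .r1 i j)))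
  | .agg j => .mod (.add (F j) (sumExpr (List.ofFn fun i => .var (.inr (.mask i j))))) n

theorem plainExpr_eval (K : Key) {L : ℕ} (inp : List ℕ) (ω : Coins N m K) (n : CoinExpr L N m)
    (hn : n.eval (coinEnv inp L ω) = K.n) (d : Bool → Fin N → Fin m → ℕ) (s : Bool)
    (i : Fin N) (j : Fin m) :
    (plainExpr n d s i j).eval (coinEnv inp L ω) = (hybridPlain K d ω s i j).val := by
  rw [plainExpr, Expr.eval, hn]
  cases s
  · simp [Expr.eval, hybridPlain, ZMod.val_natCast]
  · simp [Expr.eval, hybridPlain, ZMod.val_natCast, ZMod.val_add, coinEnv, Coins.env]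

theorem entryExpr_eval (K : Key) {L : ℕ} (inp : List ℕ) (ω : Coins N m K)
    (n g : CoinExpr L N m) (F : Fin m → CoinExpr L N m) (F' : Fin m → ℕ)
    (hn : n.eval (coinEnv inp L ω) = K.n) (hg : g.eval (coinEnv inp L ω) = K.gen.val)
    (hF : ∀ j, (F j).eval (coinEnv inp L ω) = F' j) (d : Bool → Fin N → Fin m → ℕ)
    (e : Entry N m) :
    (entryExpr n g F d e).eval (coinEnv inp L ω) = hybridValue K F' d ω e := by
  cases e with
  | n => exact hn
  | g => exact hg
  | rOp j | R j | mask i j => rfl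
  | cipher s i j =>
    refine encExpr_eval K _ _ _ _ _ _ _ hn hg (plainExpr_eval K inp ω n hn d s i j) ?_
    cases s <;> rfl
  | agg j =>
    have h : ∀ x : ZMod K.n, ∀ y : ℕ, (y : ZMod K.n) = x → y % K.n = x.val := fun x y hxy => by
      rw [← hxy, ZMod.val_natCast]
    rw [entryExpr, Expr.eval, hn]
    refine h _ _ ?_
    rw [Expr.eval, hF, sumExpr_eval, List.map_ofFn, List.sum_ofFn]
    push_cast
    congr 1
    refine Finset.sum_congr rfl fun i _ => ?_
    exact ZMod.natCast_zmod_val _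

/-- The simulator of the operator. -/
def operatorSim (N m S : ℕ) : Prog :=
  coinProg (L := 2 + m) (.var ⟨0, by omega⟩) ((entries N m).map
    (entryExpr (.var (.inl ⟨0, by omega⟩)) (.var (.inl ⟨1, by omega⟩))
      (fun j => .mul (.const S) (.var (.inl ⟨2 + j, by omega⟩))) fun _ _ _ => 0))

theorem operatorSim_exec (f : ℕ → ℕ) (S : ℕ) (K : Key) (b : Fin N → Fin m → Bool) :
    (operatorSim N m S).exec (operatorLeak f K b) = (coins N m K).map
      (hybridView K (fun j => S * f (usersAt b j)) fun _ _ _ => 0) := by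
  rw [operatorSim, coinProg_exec _ _ K _ rfl]
  congr 1
  funext ω
  rw [List.map_map]
  refine List.map_congr_left fun e _ => ?_
  refine entryExpr_eval K _ ω _ _ _ _ rfl rfl (fun j => ?_) _ e
  simp only [Expr.eval, coinEnv, Sum.elim_inl]
  congr 1
  rw [← List.append_nil (operatorLeak f K b)]
  exact getD_append_ofFn K.pub (fun j => f (usersAt b j)) _ j _ rfl

/-- The first part of the chosen-plaintext adversary that distinguishes two hybrid views which
differ in one ciphertext: it makes all the random choices and outputs the two plaintexts and a
preliminary view. -/
def cpaChoose (F : Fin m → ℕ) (d : Fin 2 → Bool → Fin N → Fin m → ℕ) (s : Bool) (i : Fin N)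
    (j : Fin m) : Prog :=
  coinProg (L := 2) (.var ⟨0, by omega⟩)
    (plainExpr (.var (.inl ⟨0, by omega⟩)) (d 0) s i j ::
      plainExpr (.var (.inl ⟨0, by omega⟩)) (d 1) s i j ::
      (entries N m).map (entryExpr (.var (.inl ⟨0, by omega⟩)) (.var (.inl ⟨1, by omega⟩))
        (fun j => .const (F j)) (d 0)))

theorem cpaChoose_exec (K : Key) (F : Fin m → ℕ) (d : Fin 2 → Bool → Fin N → Fin m → ℕ)
    (s : Bool) (i : Fin N) (j : Fin m) :
    (cpaChoose F d s i j).exec K.pub = (coins N m K).map fun ω =>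
      (hybridPlain K (d 0) ω s i j).val :: (hybridPlain K (d 1) ω s i j).val ::
        hybridView K F (d 0) ω := by
  rw [cpaChoose, coinProg_exec _ _ K _ rfl]
  congr 1
  funext ω
  rw [List.map_cons, List.map_cons, plainExpr_eval K _ ω _ rfl, plainExpr_eval K _ ω _ rfl,
    List.map_map]
  congr 2
  exact List.map_congr_left fun e _ => entryExpr_eval K _ ω _ _ _ _ rfl rfl (fun j => rfl) _ e

open Classical in
/-- The positions from which the second part of the adversary assembles the hybrid view: the
challenge comes after the two plaintexts and the preliminary view. -/
def challengeIndex (s : Bool) (i : Fin N) (j : Fin m) : List ℕ :=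
  (List.range (entries N m).length).map fun t =>
    if (entries N m)[t]? = some (.cipher s i j) then (entries N m).length + 2
      else t + 2

/-- Code that inserts the challenge into the preliminary view. -/
def insertChallenge (s : Bool) (i : Fin N) (j : Fin m) : List Instr :=
  rearrangeCode (challengeIndex s i j) ((entries N m).length + 3)

theorem run_insertChallenge (K : Key) (F : Fin m → ℕ) (d d' : Bool → Fin N → Fin m → ℕ)
    (s : Bool) (i : Fin N) (j : Fin m)
    (hd : ∀ s' i' j', ¬(s' = s ∧ i' = i ∧ j' = j) → d s' i' j' = d' s' i' j')
    (ω : Coins N m K) (ρ : (ZMod K.n)ˣ) (x y : ℕ) :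
    run (insertChallenge s i j) (fun t => ((x :: y :: hybridView K F d' ω) ++
        [(K.enc (hybridPlain K d ω s i j) ρ).val]).getD t 0) =
      PMF.pure fun t => (hybridView K F d (ω.setRand s i j ρ)).getD t 0 := by
  classical
  set inp := (x :: y :: hybridView K F d' ω) ++ [(K.enc (hybridPlain K d ω s i j) ρ).val]
    with hinp
  have hvl : (hybridView K F d' ω).length = (entries N m).length := List.length_map _
  have hlen : inp.length = (entries N m).length + 3 := by
    rw [hinp]; simp [hvl]
  have hil : (challengeIndex (N := N) (m := m) s i j).length = (entries N m).length := by
    simp [challengeIndex]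
  rw [insertChallenge, run_rearrangeCode _ _ _ fun t ht => List.getD_eq_default _ _ (by omega)]
  · congr 1
    funext t
    congr 1
    refine List.ext_getElem (by simp [hil, hybridView]) fun a h1 h2 => ?_
    have ha : a < (entries N m).length := by simpa [hybridView] using h2
    simp only [challengeIndex, hybridView, List.getElem_map, List.getElem_range,
      hybridValue_setRand K F d d' s i j hd, List.getElem?_eq_getElem ha, Option.some_inj]
    split_ifs with he
    · rw [hinp, List.getD_append_right _ _ _ _ (by simp [hvl])]
      simp [hvl]
    · rw [hinp, List.getD_append _ _ _ _ (by simp [hvl]; omega)]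
      simp [hybridView, ha]
  · intro a ha
    obtain ⟨t, ht, rfl⟩ := List.mem_map.1 ha
    rw [List.mem_range] at ht
    split_ifs <;> omega
  · omega

/-! ### The reduction to semantic security -/

/-- The ensemble of hybrid views. -/
def hybridEnsemble (G : ℕ → PMF Key) (F : Fin m → ℕ) (d : Bool → Fin N → Fin m → ℕ) (k : ℕ) :
    PMF (List ℕ) := (G k).bind fun K => (coins N m K).map (hybridView K F d)

theorem coins_resample {K : Key} {γ : Type} (s : Bool) (i : Fin N) (j : Fin m)
    (F : Coins N m K → PMF γ) :
    ((coins N m K).bind fun ω => (PMF.uniformOfFintype (ZMod K.n)ˣ).bind fun ρ =>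
      F (ω.setRand s i j ρ)) = (coins N m K).bind F :=
  uniform_resample (α := Coins N m K) (β := (ZMod K.n)ˣ) (fun ω => Coins.rand ω s i j)
    (fun ω ρ => Coins.setRand s i j ω ρ) (Coins.rand_setRand_self s i j) (Coins.setRand_rand s i j) (Coins.setRand_setRand s i j) F

theorem natCast_getD_pair (K : Key) (x : Fin 2 → ZMod K.n) (l : List ℕ) (β : Fin 2) :
    ((((x 0).val :: (x 1).val :: l).getD β 0 : ℕ) : ZMod K.n) = x β := by
  revert β
  exact Fin.forall_fin_two.2 ⟨ZMod.natCast_zmod_val _, ZMod.natCast_zmod_val _⟩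

theorem cpaExperiment_eq (G : ℕ → PMF Key) (D : ℕ → Prog) (F : Fin m → ℕ)
    (d : Fin 2 → Bool → Fin N → Fin m → ℕ) (s : Bool) (i : Fin N) (j : Fin m)
    (hd : ∀ s' i' j', ¬(s' = s ∧ i' = i ∧ j' = j) → d 1 s' i' j' = d 0 s' i' j')
    (k : ℕ) (β : Fin 2) :
    cpaExperiment G (fun _ => cpaChoose F d s i j)
        (fun k => ⟨insertChallenge s i j ++ (D k).code, (D k).out⟩) k β =
      ((hybridEnsemble G F (d β) k).bind (D k).exec).map fun o => o.headD 0 := by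
  have hd' : ∀ s' i' j', ¬(s' = s ∧ i' = i ∧ j' = j) → d β s' i' j' = d 0 s' i' j' := by
    revert β
    exact Fin.forall_fin_two.2 ⟨fun _ _ _ _ => rfl, hd⟩
  rw [hybridEnsemble, PMF.bind_bind, PMF.map_bind, cpaExperiment]
  congr 1
  funext K
  rw [cpaChoose_exec, PMF.bind_map, PMF.bind_map, PMF.map_bind]
  refine Eq.trans ?_ (coins_resample s i j _)
  refine congrArg (PMF.bind _) (funext fun ω => congrArg (PMF.bind _) (funext fun ρ =>
    congrArg (PMF.map _) ?_))
  have hmsg := natCast_getD_pair K (fun β => hybridPlain K (d β) ω s i j)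
    (hybridView K F (d 0) ω) β
  rw [hmsg]
  exact exec_prepend _ _ _ _ (run_insertChallenge K F (d β) (d 0) s i j hd' ω ρ _ _)

theorem hybrid_step {G : ℕ → PMF Key} (hG : SemanticallySecure G) {D : ℕ → Prog}
    (hD : PolyTime D) (F : Fin m → ℕ) (d d' : Bool → Fin N → Fin m → ℕ) (s : Bool) (i : Fin N)
    (j : Fin m) (hd : ∀ s' i' j', ¬(s' = s ∧ i' = i ∧ j' = j) → d s' i' j' = d' s' i' j') :
    Negligible fun k => |acceptProb (D k) (hybridEnsemble G F d k) -
      acceptProb (D k) (hybridEnsemble G F d' k)| := by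
  have h := hG (fun _ => cpaChoose F ![d, d'] s i j)
    (fun k => ⟨insertChallenge s i j ++ (D k).code, (D k).out⟩) (Prog.isPPT _) (hD.prepend _)
  simp only [cpaExperiment_eq G D F ![d, d'] s i j (fun s' i' j' h => (hd s' i' j' h).symm)] at h
  exact h

theorem Negligible.of_abs_le {ε δ : ℕ → ℝ} (h : Negligible ε) (hδ : ∀ k, |δ k| ≤ |ε k|) :
    Negligible δ := Asymptotics.SuperpolynomialDecay.trans_abs_le h hδ

theorem hybrid_negligible {G : ℕ → PMF Key} (hG : SemanticallySecure G) {D : ℕ → Prog}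
    (hD : PolyTime D) (F : Fin m → ℕ) (d : Bool → Fin N → Fin m → ℕ) :
    Negligible fun k => |acceptProb (D k) (hybridEnsemble G F d k) -
      acceptProb (D k) (hybridEnsemble (N := N) G F (fun _ _ _ => 0) k)| := by
  classical
  have key : ∀ A : Finset (Bool × Fin N × Fin m),
      Negligible fun k => |acceptProb (D k)
        (hybridEnsemble G F (fun s i j => if (s, i, j) ∈ A then d s i j else 0) k) -
          acceptProb (D k) (hybridEnsemble (N := N) G F (fun _ _ _ => 0) k)| := by
    intro A
    induction A using Finset.induction_on with
    | empty =>
      simp only [Finset.notMem_empty, if_false, sub_self, abs_zero]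
      exact Asymptotics.superpolynomialDecay_zero _ _
    | insert a A ha ih =>
      obtain ⟨s, i, j⟩ := a
      have h := hybrid_step hG hD F
        (fun s' i' j' => if (s', i', j') ∈ insert (s, i, j) A then d s' i' j' else 0)
        (fun s' i' j' => if (s', i', j') ∈ A then d s' i' j' else 0) s i j
        (fun s' i' j' hne => by
          have : (s', i', j') ≠ (s, i, j) := by
            intro h
            simp only [Prod.mk.injEq] at h
            exact hne h
          simp only [Finset.mem_insert, this, false_or])
      refine Negligible.of_abs_le (Asymptotics.SuperpolynomialDecay.add h ih) fun k => ?_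
      rw [abs_abs]
      exact (abs_sub_le _ _ _).trans (le_abs_self _)
  simpa using key Finset.univ

theorem operator_indist (f : ℕ → ℕ) (S : ℕ) (hf0 : f 0 = 0)
    (hround : ∀ x, 1 ≤ x → x ≤ N → x ∣ S * f x) {G : ℕ → PMF Key} (hgen : IsKeyGen G)
    (hG : SemanticallySecure G) :
    CompIndist
      (fun (k : ℕ) (b : Fin N → Fin m → Bool) =>
        (G k).bind fun K => (coins N m K).map (operatorView f S K b))
      (fun (k : ℕ) (b : Fin N → Fin m → Bool) =>
        (G k).bind fun K => (operatorSim N m S).exec (operatorLeak f K b)) := by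
  intro D hD
  set δ : (Fin N → Fin m → Bool) → ℕ → ℝ := fun b k =>
    |acceptProb (D k) ((G k).bind fun K => (coins N m K).map (operatorView f S K b)) -
      acceptProb (D k) ((G k).bind fun K => (operatorSim N m S).exec (operatorLeak f K b))|
    with hδ
  refine ⟨fun k => ∑ b, δ b k, ?_, fun k b =>
    Finset.single_le_sum (f := fun b => δ b k) (fun b _ => abs_nonneg _) (Finset.mem_univ b)⟩
  have hneg : ∀ b, Negligible (δ b) := fun b => by
    refine Asymptotics.SuperpolynomialDecay.congr' (hybrid_negligible hG hD
      (fun j => S * f (usersAt b j)) (realSummand f S b)) ?_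
    filter_upwards [Filter.eventually_ge_atTop (2 * N + 1)] with k hk
    simp only [hδ, operatorSim_exec]
    rw [hybridEnsemble, hybridEnsemble]
    congr 3
    refine pmf_bind_congr _ _ _ fun K hK => ?_
    obtain ⟨P, hP⟩ := hgen
    obtain ⟨h1, -, -⟩ := hP k K hK
    have h2 : k < 2 ^ k := Nat.lt_two_pow_self
    have h3 : K.p ≤ K.n := Nat.le_mul_of_pos_right _ K.prime_q.pos
    congr 1
    funext ω
    exact (operatorView_eq f S K b ω hf0 hround (by omega)).symm
  have hsum : ∀ A : Finset (Fin N → Fin m → Bool), Negligible fun k => ∑ b ∈ A, δ b k := by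
    classical
    intro A
    induction A using Finset.induction_on with
    | empty =>
      simp only [Finset.sum_empty]
      exact Asymptotics.superpolynomialDecay_zero _ _
    | insert b A hb ih =>
      simp only [Finset.sum_insert hb]
      exact Asymptotics.SuperpolynomialDecay.add (hneg b) ih
  exact hsum Finset.univ

end

end PPCFS

end

theorem theorem2 (N m r S : ℕ) (C : Fin (r + 1) → ℕ) (f : ℕ → ℕ)
    (hC : PPCFS.IsCapacitySeq N C) (hf : PPCFS.IsEstimation C f)
    -- the scaling factor eliminates rounding errors
    (hS : 0 < S) (hround : ∀ x, 1 ≤ x → x ≤ N → x ∣ S * f x) :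
    -- the parties obtain their prescribed outputs
    (∀ (K : PPCFS.Key) (b : Fin N → Fin m → Bool) (ω : PPCFS.Coins N m K),
      2 * N < K.n → 2 * (S * r) < K.n →
        (∀ i j, PPCFS.userOutput K b ω i j = PPCFS.userShare b i j) ∧
        (∀ j, PPCFS.operatorOutput f S K b ω j = f (PPCFS.usersAt b j))) ∧
    -- the operator learns nothing beyond `f(N^j)`
    (∃ Sim : PPCFS.Prog, Sim.IsPPT ∧
      ∀ G : ℕ → PMF PPCFS.Key, PPCFS.IsKeyGen G → PPCFS.SemanticallySecure G →
        PPCFS.CompIndist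
          (fun (k : ℕ) (b : Fin N → Fin m → Bool) =>
            (G k).bind fun K => (PPCFS.coins N m K).map (PPCFS.operatorView f S K b))
          (fun (k : ℕ) (b : Fin N → Fin m → Bool) =>
            (G k).bind fun K => Sim.exec (PPCFS.operatorLeak f K b))) ∧
    -- user `i` learns nothing beyond `N^j` for the timeslots that he requests
    (∀ i : Fin N, ∃ Sim : PPCFS.Prog, Sim.IsPPT ∧
      ∀ (K : PPCFS.Key) (b : Fin N → Fin m → Bool),
        (PPCFS.coins N m K).map (fun ω => PPCFS.userView f S K b ω i) =
          Sim.exec (PPCFS.userLeak K b i)) := by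
  refine ⟨fun K b ω hn hn' => ⟨PPCFS.userOutput_eq K b ω hn,
    PPCFS.operatorOutput_eq f S K b ω hS hf.1 hf.2.1 hround hn hn'⟩,
    ⟨PPCFS.operatorSim N m S, PPCFS.Prog.isPPT _, fun G hgen hG =>
      PPCFS.operator_indist f S hf.1 hround hgen hG⟩,
    PPCFS.exists_user_simulator f S⟩
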